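/- Let $N$ be an infinite abelian group on which $\mathbb Z=\langle x\rangle$ acts by automorphisms, and suppose that $G=N\rtimes\mathbb Z$ is finitely generated. For $n\ge 1$ let $m_n(G)$ be the number of maximal subgroups of $G$ of index $n$. Write $N$ additively and regard it as a $\mathbb Z[x,x^{-1}]$-module, $x$ acting by conjugation in $G$. By the structure theorem over the principal ideal domain $\mathbb Q[x,x^{-1}]$, write \[ \mathbb Q\otimes_{\mathbb Z}N\;\cong\;\Bigl(\bigoplus_{j=1}^{s(0)}\mathbb Q[x,x^{-1}]/(a_j)\Bigr)\oplus\mathbb Q[x,x^{-1}]^{r(0)} \] as $\mathbb Q[x,x^{-1}]$-modules, where the $a_j$ are nonzero non-units with $a_1\mid a_2\mid\cdots\mid a_{s(0)}$, and let $d=s(0)+r(0)$. For a prime $p$ let $r(p)$ be the torsion-free rank of the $\mathbb F_p[x]$-module $N/pN$, and let $r_{\max}=\max_p r(p)$, the maximum over all primes $p$. Say that $f\colon\{1,2,3,\dots\}\to\mathbb R$ has growth type $g$ if there is a constant $C$ with $|f(n)|\le C\,g(n)$ for all large $n$, and there is a constant $C'>0$ with $C'g(n)\le f(n)$ for infinitely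 many $n$. Then the function $n\mapsto m_n(G)$ has growth type \[ \begin{cases} n^{d} & \text{if } d>r_{\max},\\ n^{d+1} & \text{if } d=r_{\max}=r(0),\\ n^{r_{\max}+1}/\log n & \text{otherwise.} \end{cases} \] -/

import Mathlib

open scoped LaurentPolynomial Polynomial TensorProduct

/-- `f` has growth type `g`: `f(n) = O(g(n))`, and for some `C > 0` one has `C g(n) ≤ f(n)` for
infinitely many `n`. -/
def HasGrowthType (f g : ℕ → ℝ) : Prop :=
  (∃ C : ℝ, ∀ᶠ n in Filter.atTop, |f n| ≤ C * g n) ∧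
  (∃ C : ℝ, 0 < C ∧ ∃ᶠ n in Filter.atTop, C * g n ≤ f n)

/-- `m_n(G)`, the number of maximal subgroups of `G` of index `n`
(for `n ≥ 1` and `G` finitely generated there are only finitely many of them). -/
noncomputable def maxSubgroupCount (G : Type*) [Group G] (n : ℕ) : ℕ :=
  {H : Subgroup G | IsCoatom H ∧ H.index = n}.ncard

/-- The `K`-module `M`, regarded as a module over the Laurent polynomial ring `K[x, x⁻¹]` on which
`x` acts as the automorphism `u`. -/
@[nolint unusedArguments]
def LaurentModule {K M : Type*} [CommRing K] [AddCommGroup M] [Module K M] (_u : M ≃ₗ[K] M) :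
    Type _ := M

/-- The ring homomorphism `K[x, x⁻¹] → End_K(M)` sending `x` to `u`. -/
noncomputable def laurentAction {K M : Type*} [CommRing K] [AddCommGroup M] [Module K M]
    (u : M ≃ₗ[K] M) : K[T;T⁻¹] →ₐ[K] Module.End K M :=
  AddMonoidAlgebra.lift K (Module.End K M) ℤ
    ((LinearEquiv.automorphismGroup.toLinearMapMonoidHom (R := K) (M := M)).comp
      (zpowersHom (M ≃ₗ[K] M) u))

instance LaurentModule.instAddCommGroup {K M : Type*} [CommRing K] [AddCommGroup M] [Module K M]
    (u : M ≃ₗ[K] M) : AddCommGroup (LaurentModule u) :=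
  inferInstanceAs (AddCommGroup M)

noncomputable instance LaurentModule.instModule {K M : Type*} [CommRing K] [AddCommGroup M]
    [Module K M] (u : M ≃ₗ[K] M) : Module K[T;T⁻¹] (LaurentModule u) :=
  letI : Module (Module.End K M) (LaurentModule u) := inferInstanceAs (Module (Module.End K M) M)
  Module.compHom (LaurentModule u) (laurentAction u).toRingHom

theorem LaurentModule.smul_def {K M : Type*} [CommRing K] [AddCommGroup M] [Module K M]
    (u : M ≃ₗ[K] M) (f : K[T;T⁻¹]) (m : M) :
    (f • (show LaurentModule u from m) : LaurentModule u) = (laurentAction u f m : M) := rfl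

theorem LaurentModule.T_one_smul {K M : Type*} [CommRing K] [AddCommGroup M] [Module K M]
    (u : M ≃ₗ[K] M) (m : M) :
    ((LaurentPolynomial.T 1 : K[T;T⁻¹]) • (show LaurentModule u from m) : LaurentModule u)
      = (u m : M) := by
  rw [LaurentModule.smul_def]
  have h : laurentAction u (LaurentPolynomial.T 1) = (u : M →ₗ[K] M) := by
    unfold laurentAction LaurentPolynomial.T
    rw [AddMonoidAlgebra.lift_single, one_smul]
    simp only [MonoidHom.comp_apply, zpowersHom_apply, toAdd_ofAdd, zpow_one]
    rfl
  rw [h]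
  rfl

theorem LaurentModule.C_smul {K M : Type*} [CommRing K] [AddCommGroup M] [Module K M]
    (u : M ≃ₗ[K] M) (c : K) (m : M) :
    ((LaurentPolynomial.C c : K[T;T⁻¹]) • (show LaurentModule u from m) : LaurentModule u)
      = (c • m : M) := by
  rw [LaurentModule.smul_def]
  change laurentAction u (algebraMap K K[T;T⁻¹] c) m = _
  rw [AlgHom.commutes, Module.algebraMap_end_apply]

section Semidirect

variable {N : Type*} [CommGroup N] (φ : Multiplicative ℤ →* MulAut N)

/-- The action on `N` (written additively) of the generator `x` of `ℤ`. In `N ⋊[φ] ℤ` it is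
conjugation by `x`. -/
def generatorAction : Additive N ≃ₗ[ℤ] Additive N :=
  (MulEquiv.toAdditive (φ (Multiplicative.ofAdd 1))).toIntLinearEquiv

/-- `ℚN = ℚ ⊗_ℤ N` as a module over `ℚ[x, x⁻¹]`. -/
abbrev RationalModule : Type _ :=
  LaurentModule ((generatorAction φ).baseChange ℤ ℚ (Additive N) (Additive N))

variable (N) in
/-- The group `N / pN` (with `N` written additively). -/
abbrev ReductionModP (p : ℕ) : Type _ :=
  Additive N ⧸ (nsmulAddMonoidHom (α := Additive N) p).range

instance ReductionModP.instModule (p : ℕ) : Module (ZMod p) (ReductionModP N p) :=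
  AddCommGroup.zmodModule (n := p) (by
    intro y
    induction y using QuotientAddGroup.induction_on with
    | H z => exact (QuotientAddGroup.eq_zero_iff _).2 ⟨z, rfl⟩)

/-- The `𝔽_p`-linear map by which `x` acts on `N / pN`. -/
def generatorActionModP (p : ℕ) : ReductionModP N p →ₗ[ZMod p] ReductionModP N p :=
  AddMonoidHom.toZModLinearMap p
    (QuotientAddGroup.map _ _ (generatorAction φ).toAddEquiv.toAddMonoidHom (by
      rintro _ ⟨z, rfl⟩
      exact ⟨generatorAction φ z, (map_nsmul (generatorAction φ).toAddEquiv p z).symm⟩))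

/-- `r(p)`, the (torsion-free) rank of the `𝔽_p[x]`-module `N / pN`. -/
noncomputable def modPRank (p : ℕ) : ℕ :=
  Module.finrank (ZMod p)[X] (Module.AEval' (generatorActionModP φ p))

/-- `r_max`, the maximum of `r(p)` over all primes `p`. -/
noncomputable def maxModPRank : ℕ :=
  ⨆ p : Nat.Primes, modPRank φ p

end Semidirect

/-!
Write `L = ℤ[x, x⁻¹]` and `G = N ⋊ ℤ`. Since `G` is finitely generated, `N` is a finitely
generated `L`-module (`finite_integralModule`).

*From subgroups to submodules.* For each `n` at most one subgroup of index `n` contains `N`. A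
maximal subgroup `H` not containing `N` contains an element `(v, x)`, and `W = H ∩ N` is a maximal
submodule of `N`; the pair `(W, v mod W)` determines `H`, and all pairs occur. Hence `m_n(G)` is
`n` times the number `c(n)` of maximal submodules of index `n`, up to an error of at most one
(`maxSubgroupCount_le`, `le_maxSubgroupCount`).

*From submodules to semilinear maps.* The number `c(n)` vanishes unless `n = p ^ k` is a prime
power. In that case let `F` be a field of `n` elements. Every maximal submodule of index `n` is
the kernel of a nonzero map `N → F` which is semilinear along a surjective ring homomorphism
`l : L → F`, and the pairs of such maps with a given kernel are permuted simply transitively by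
`Aut F × Fˣ`. Counting them gives `c(n) k (n - 1) = ∑ (n ^ d(l) - 1)`, where `l` runs over the surjective
homomorphisms and `d(l)` is the dimension of the space of semilinear maps along `l`
(`maxSubmoduleCount_mul_eq`). A homomorphism `l` is a nonzero element of `F`, so there are fewer
than `n` of them; all are surjective if `k = 1`, and at least `n - p` are if `k` is prime.

*The dimensions.* For a fixed `p`, there is a Laurent polynomial `A`, nonzero mod `p`, such that
`d(l) = r(p)` unless `l A = 0`; if `l` is surjective this exception forces `k` to be bounded
(`exists_homDim_eq_modPRank`, `le_card_zero_of_surjective`). For all but finitely many `p`,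
clearing denominators in the decomposition of `ℚ ⊗ N` gives `d(l) ≤ d`, with `d(l) ≤ r(0)` outside
the boundedly many zeros of a fixed Laurent polynomial, and `d(l) ≥ d` if `l` is a common zero of
the `a_j` (`exists_homDim_bounds`). As `a_1` divides all of them, and has a nonzero root modulo
infinitely many primes, the last case occurs infinitely often with `k = 1` if `s(0) > 0`
(`infinite_setOf_prime_hom`). If `s(0) = 0` it occurs for all `l`, so that `r(0) ≤ r_max`
(`le_maxModPRank`).

*Growth.* Almost all primes contribute `O(n ^ (r(0) + 1) + n ^ d)` to `m_n(G)`. A remaining prime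
`p` contributes `O(n ^ (r(p) + 1) / k)`, and `k` is proportional to `log n`; together this is the
upper bound `exists_maxSubgroupCount_le`. It is attained, in the respective cases, at the primes
modulo which `a_1` has a root, at almost all primes, and at the powers `p ^ k` with `k` prime
where `r(p) = r_max`. In the second case `r(0) > 0`, as otherwise `N` would be finite
(`finite_of_modPRank_eq_zero`).
-/


/-! ### Maximal subgroups of the semidirect product -/

/-- The number of maximal submodules of index `n` of a module (zero if there are infinitely
many). -/
noncomputable def maxSubmoduleCount (R V : Type*) [CommRing R] [AddCommGroup V] [Module R V]
    (n : ℕ) : ℕ :=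
  {W : Submodule R V | IsCoatom W ∧ Nat.card (V ⧸ W) = n}.ncard

section SemidirectProduct

variable {N : Type*} [CommGroup N] (φ : Multiplicative ℤ →* MulAut N)

/-- The group `N`, written additively, as a module over `ℤ[x, x⁻¹]`. -/
abbrev IntegralModule : Type _ := LaurentModule (generatorAction φ)

/-- The identity map, from `N` to the Laurent module it carries. -/
def toIntegralModule : Additive N ≃+ IntegralModule φ := AddEquiv.refl _

theorem laurentAction_T {K M : Type*} [CommRing K] [AddCommGroup M] [Module K M]
    (u : M ≃ₗ[K] M) (k : ℤ) :
    laurentAction u (LaurentPolynomial.T k) = ((u ^ k : M ≃ₗ[K] M) : M →ₗ[K] M) := by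
  unfold laurentAction LaurentPolynomial.T
  rw [AddMonoidAlgebra.lift_single, one_smul]
  simp only [MonoidHom.comp_apply, zpowersHom_apply, toAdd_ofAdd]
  rfl

theorem generatorAction_zpow_apply (k : ℤ) (v : Additive N) :
    (generatorAction φ ^ k) v = Additive.ofMul (φ (Multiplicative.ofAdd k) v.toMul) := by
  induction k using Int.induction_on generalizing v with
  | zero => simp
  | succ k ih =>
    rw [zpow_add_one, LinearEquiv.mul_apply, ih]
    rw [ofAdd_add, map_mul, MulAut.mul_apply]
    rfl
  | pred k ih =>
    have h : v = generatorAction φ ((generatorAction φ).symm v) := by simp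
    have h2 : (generatorAction φ ^ (-(k : ℤ) - 1)) v =
        (generatorAction φ ^ (-(k : ℤ))) ((generatorAction φ).symm v) := by
      rw [zpow_sub_one, LinearEquiv.mul_apply]; rfl
    rw [h2, ih]
    nth_rewrite 2 [h]
    rw [sub_eq_add_neg, ofAdd_add, map_mul, MulAut.mul_apply]
    congr 2
    rw [ofAdd_neg, map_inv]
    exact ((MulAut.inv_apply_self _ _ _).symm)

theorem T_smul_toIntegralModule (k : ℤ) (u : N) :
    (LaurentPolynomial.T k : ℤ[T;T⁻¹]) • toIntegralModule φ (Additive.ofMul u)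
      = toIntegralModule φ (Additive.ofMul (φ (Multiplicative.ofAdd k) u)) := by
  refine (LaurentModule.smul_def (generatorAction φ) _ _).trans ?_
  rw [laurentAction_T]
  exact generatorAction_zpow_apply φ k _

/-- A subgroup of `N` stable under `ℤ` is a submodule. -/
def submoduleOfStable (S : Subgroup N) (hS : ∀ k : ℤ, ∀ u ∈ S, φ (Multiplicative.ofAdd k) u ∈ S) :
    Submodule ℤ[T;T⁻¹] (IntegralModule φ) where
  carrier := {v | ((toIntegralModule φ).symm v).toMul ∈ S}
  add_mem' {a b} ha hb := S.mul_mem ha hb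
  zero_mem' := S.one_mem
  smul_mem' f v hv := by
    have hadd : ∀ a b : IntegralModule φ, ((toIntegralModule φ).symm a).toMul ∈ S →
      ((toIntegralModule φ).symm b).toMul ∈ S → ((toIntegralModule φ).symm (a + b)).toMul ∈ S :=
      fun a b ha hb => S.mul_mem ha hb
    induction f using LaurentPolynomial.induction_on' with
    | add p q hp hq => rw [add_smul]; exact hadd _ _ hp hq
    | C_mul_T n a =>
      obtain ⟨u, hu⟩ : ∃ u, v = toIntegralModule φ (Additive.ofMul u) := ⟨v, rfl⟩
      rw [hu] at hv ⊢
      rw [mul_smul, T_smul_toIntegralModule]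
      set w := φ (Multiplicative.ofAdd n) u with hw
      have h : (LaurentPolynomial.C a : ℤ[T;T⁻¹]) • toIntegralModule φ (Additive.ofMul w) =
          toIntegralModule φ (a • Additive.ofMul w) :=
        LaurentModule.C_smul (generatorAction φ) a (Additive.ofMul w)
      rw [h]
      exact S.zpow_mem (hS n u hv) a

open SemidirectProduct in
theorem zpow_mul_inl_mul_zpow_neg (s : N ⋊[φ] Multiplicative ℤ) (k : ℤ) (u : N) :
    s ^ k * inl u * (s ^ k)⁻¹ = inl (φ (s.right ^ k) u) := by
  have hr : (s ^ k).right = s.right ^ k := map_zpow (rightHom (φ := φ)) s k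
  ext
  · simp [hr, mul_comm, mul_assoc]
  · simp


/-- The subgroup of `N` underlying a submodule. -/
def subgroupOfSubmodule (W : Submodule ℤ[T;T⁻¹] (IntegralModule φ)) : Subgroup N where
  carrier := {u | toIntegralModule φ (Additive.ofMul u) ∈ W}
  mul_mem' ha hb := W.add_mem ha hb
  one_mem' := W.zero_mem
  inv_mem' ha := W.neg_mem ha

variable {φ}

theorem mem_subgroupOfSubmodule {W : Submodule ℤ[T;T⁻¹] (IntegralModule φ)} {u : N} :
    u ∈ subgroupOfSubmodule φ W ↔ toIntegralModule φ (Additive.ofMul u) ∈ W := Iff.rfl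

theorem act_mem_subgroupOfSubmodule (W : Submodule ℤ[T;T⁻¹] (IntegralModule φ)) {u : N}
    (hu : u ∈ subgroupOfSubmodule φ W) (k : Multiplicative ℤ) :
    φ k u ∈ subgroupOfSubmodule φ W := by
  have := W.smul_mem (LaurentPolynomial.T k.toAdd) (mem_subgroupOfSubmodule.1 hu)
  rwa [T_smul_toIntegralModule] at this

open SemidirectProduct

/-- The subgroup generated by a submodule `W` of `N` and the element `s` of `N ⋊ ℤ`: the products
of an element of `W` and a power of `s`. -/
def liftSubgroup (W : Submodule ℤ[T;T⁻¹] (IntegralModule φ)) (s : N ⋊[φ] Multiplicative ℤ) :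
    Subgroup (N ⋊[φ] Multiplicative ℤ) where
  carrier := {g | ∃ w ∈ subgroupOfSubmodule φ W, ∃ k : ℤ, g = inl w * s ^ k}
  one_mem' := ⟨1, one_mem _, 0, by simp⟩
  mul_mem' := by
    rintro _ _ ⟨w, hw, k, rfl⟩ ⟨w', hw', l, rfl⟩
    refine ⟨w * φ (s.right ^ k) w', mul_mem hw (act_mem_subgroupOfSubmodule W hw' _), k + l, ?_⟩
    rw [map_mul, ← zpow_mul_inl_mul_zpow_neg, zpow_add]
    group
  inv_mem' := by
    rintro _ ⟨w, hw, k, rfl⟩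
    refine ⟨φ (s.right ^ (-k)) w⁻¹, act_mem_subgroupOfSubmodule W (inv_mem hw) _, -k, ?_⟩
    rw [← zpow_mul_inl_mul_zpow_neg, map_inv]
    group

theorem zpow_generator_right {s : N ⋊[φ] Multiplicative ℤ} (hs : s.right = Multiplicative.ofAdd 1)
    (k : ℤ) : (s ^ k).right = Multiplicative.ofAdd k := by
  have : (s ^ k).right = s.right ^ k := map_zpow (rightHom (φ := φ)) s k
  rw [this, hs, ← ofAdd_zsmul]; simp

/-- Every element of `N ⋊ ℤ` is the product of an element of `N` and a power of a given lift `s`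
of the generator of `ℤ`. -/
theorem exists_inl_mul_zpow {s : N ⋊[φ] Multiplicative ℤ} (hs : s.right = Multiplicative.ofAdd 1)
    (g : N ⋊[φ] Multiplicative ℤ) : ∃ (u : N) (k : ℤ), g = inl u * s ^ k := by
  refine ⟨(g * (s ^ g.right.toAdd)⁻¹).left, g.right.toAdd, ?_⟩
  rw [← mul_inv_eq_iff_eq_mul]
  ext
  · simp
  · simp [zpow_generator_right hs]

theorem inl_mem_liftSubgroup {W : Submodule ℤ[T;T⁻¹] (IntegralModule φ)}
    {s : N ⋊[φ] Multiplicative ℤ} (hs : s.right = Multiplicative.ofAdd 1) {u : N} :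
    inl u ∈ liftSubgroup W s ↔ u ∈ subgroupOfSubmodule φ W := by
  constructor
  · rintro ⟨w, hw, k, h⟩
    have hr := congrArg SemidirectProduct.right h
    rw [mul_right, zpow_generator_right hs] at hr
    have hk : k = 0 := by simpa using hr.symm
    subst hk
    rw [zpow_zero, mul_one] at h
    rwa [inl_injective h]
  · intro h
    exact ⟨u, h, 0, by simp⟩

theorem self_mem_liftSubgroup (W : Submodule ℤ[T;T⁻¹] (IntegralModule φ))
    (s : N ⋊[φ] Multiplicative ℤ) : s ∈ liftSubgroup W s :=
  ⟨1, one_mem _, 1, by simp⟩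

/-- The submodule cut out on `N` by a subgroup containing a lift `s` of the generator of `ℤ`. -/
def traceSubmodule (H : Subgroup (N ⋊[φ] Multiplicative ℤ)) {s : N ⋊[φ] Multiplicative ℤ}
    (hs : s.right = Multiplicative.ofAdd 1) (hsH : s ∈ H) :
    Submodule ℤ[T;T⁻¹] (IntegralModule φ) :=
  submoduleOfStable φ (H.comap inl) (by
    intro k u hu
    rw [Subgroup.mem_comap] at hu ⊢
    have := zpow_mul_inl_mul_zpow_neg φ s k u
    rw [hs, ← ofAdd_zsmul, smul_eq_mul, mul_one] at this
    rw [← this]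
    exact mul_mem (mul_mem (zpow_mem hsH k) hu) (inv_mem (zpow_mem hsH k)))

theorem liftSubgroup_traceSubmodule (H : Subgroup (N ⋊[φ] Multiplicative ℤ))
    {s : N ⋊[φ] Multiplicative ℤ} (hs : s.right = Multiplicative.ofAdd 1) (hsH : s ∈ H) :
    liftSubgroup (traceSubmodule H hs hsH) s = H := by
  ext g
  constructor
  · rintro ⟨w, hw, k, rfl⟩
    exact mul_mem hw (zpow_mem hsH k)
  · intro hg
    obtain ⟨u, k, rfl⟩ := exists_inl_mul_zpow hs g
    exact ⟨u, (mul_mem_cancel_right (zpow_mem hsH k)).1 hg, k, rfl⟩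

theorem subgroupOfSubmodule_le_iff {W W' : Submodule ℤ[T;T⁻¹] (IntegralModule φ)} :
    (∀ u, u ∈ subgroupOfSubmodule φ W → u ∈ subgroupOfSubmodule φ W') ↔ W ≤ W' := Iff.rfl

theorem traceSubmodule_liftSubgroup (W : Submodule ℤ[T;T⁻¹] (IntegralModule φ))
    {s : N ⋊[φ] Multiplicative ℤ} (hs : s.right = Multiplicative.ofAdd 1)
    (h : s ∈ liftSubgroup W s) : traceSubmodule (liftSubgroup W s) hs h = W :=
  le_antisymm (subgroupOfSubmodule_le_iff.1 fun _ hu => (inl_mem_liftSubgroup hs).1 hu)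
    (subgroupOfSubmodule_le_iff.1 fun _ hu => (inl_mem_liftSubgroup hs).2 hu)

theorem liftSubgroup_mono {W W' : Submodule ℤ[T;T⁻¹] (IntegralModule φ)}
    {s : N ⋊[φ] Multiplicative ℤ} (h : W ≤ W') : liftSubgroup W s ≤ liftSubgroup W' s := by
  rintro _ ⟨w, hw, k, rfl⟩
  exact ⟨w, h hw, k, rfl⟩

/-- Subgroups containing a fixed lift `s` of the generator of `ℤ` correspond to submodules. -/
def subgroupsContainingLift {s : N ⋊[φ] Multiplicative ℤ}
    (hs : s.right = Multiplicative.ofAdd 1) :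
    Submodule ℤ[T;T⁻¹] (IntegralModule φ) ≃o Set.Ici (Subgroup.zpowers s) where
  toFun W := ⟨liftSubgroup W s, (Subgroup.zpowers_le).2 (self_mem_liftSubgroup W s)⟩
  invFun H := traceSubmodule H.1 hs ((Subgroup.zpowers_le).1 H.2)
  left_inv W := traceSubmodule_liftSubgroup W hs _
  right_inv H := Subtype.ext (liftSubgroup_traceSubmodule H.1 hs _)
  map_rel_iff' {W W'} := by
    refine ⟨fun h => subgroupOfSubmodule_le_iff.1 fun u hu => ?_, fun h => liftSubgroup_mono h⟩
    exact (inl_mem_liftSubgroup hs).1 (h ((inl_mem_liftSubgroup hs).2 hu))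

theorem isCoatom_liftSubgroup {W : Submodule ℤ[T;T⁻¹] (IntegralModule φ)}
    {s : N ⋊[φ] Multiplicative ℤ} (hs : s.right = Multiplicative.ofAdd 1) :
    IsCoatom (liftSubgroup W s) ↔ IsCoatom W := by
  rw [← (subgroupsContainingLift hs).isCoatom_iff W]
  exact ⟨fun h => h.Ici _, fun h => h.of_isCoatom_coe_Ici⟩

theorem index_comap_of_surjective_mod {A B : Type*} [Group A] [Group B] (f : A →* B)
    (H : Subgroup B) (h : ∀ b, ∃ a, (f a)⁻¹ * b ∈ H) : (H.comap f).index = H.index := by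
  refine Nat.card_congr (Equiv.ofBijective
    (Quotient.map' f fun a b hab => ?_) ⟨?_, ?_⟩)
  · rw [QuotientGroup.leftRel_apply] at hab ⊢
    simpa using hab
  · rintro ⟨a⟩ ⟨b⟩ hab
    refine Quotient.sound' ?_
    have := Quotient.exact' hab
    rw [QuotientGroup.leftRel_apply] at this ⊢
    simpa using this
  · rintro ⟨b⟩
    obtain ⟨a, ha⟩ := h b
    refine ⟨Quotient.mk'' a, Quotient.sound' ?_⟩
    rw [QuotientGroup.leftRel_apply]
    exact ha

theorem index_liftSubgroup (W : Submodule ℤ[T;T⁻¹] (IntegralModule φ))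
    {s : N ⋊[φ] Multiplicative ℤ} (hs : s.right = Multiplicative.ofAdd 1) :
    (liftSubgroup W s).index = Nat.card (IntegralModule φ ⧸ W) := by
  rw [← index_comap_of_surjective_mod (inl (φ := φ)) (liftSubgroup W s)]
  · have : (liftSubgroup W s).comap inl = subgroupOfSubmodule φ W := by
      ext u; exact inl_mem_liftSubgroup hs
    rw [this, ← Subgroup.index_toAddSubgroup]
    rfl
  · intro g
    obtain ⟨u, k, rfl⟩ := exists_inl_mul_zpow hs g
    exact ⟨u, by simpa using zpow_mem (self_mem_liftSubgroup W s) k⟩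

/-- The element of `N ⋊ ℤ` with components `v` and the generator of `ℤ`. -/
def generatorLift (v : IntegralModule φ) : N ⋊[φ] Multiplicative ℤ :=
  ⟨((toIntegralModule φ).symm v).toMul, Multiplicative.ofAdd 1⟩

theorem generatorLift_mem_liftSubgroup {W : Submodule ℤ[T;T⁻¹] (IntegralModule φ)}
    {v v' : IntegralModule φ} :
    generatorLift v' ∈ liftSubgroup W (generatorLift v) ↔ v' - v ∈ W := by
  have h : generatorLift v' = inl ((toIntegralModule φ).symm (v' - v)).toMul * generatorLift v := by
    ext
    · simp [generatorLift, -map_div]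
    · simp [generatorLift, -map_div]
  rw [h, mul_mem_cancel_right (self_mem_liftSubgroup _ _), inl_mem_liftSubgroup rfl]
  rfl

theorem liftSubgroup_eq_iff {W W' : Submodule ℤ[T;T⁻¹] (IntegralModule φ)}
    {v v' : IntegralModule φ} :
    liftSubgroup W (generatorLift v) = liftSubgroup W' (generatorLift v') ↔
      W = W' ∧ v - v' ∈ W' := by
  constructor
  · intro h
    have hW : W = W' := by
      refine le_antisymm (subgroupOfSubmodule_le_iff.1 fun u hu => ?_)
        (subgroupOfSubmodule_le_iff.1 fun u hu => ?_)
      · rw [← inl_mem_liftSubgroup (s := generatorLift v') rfl, ← h]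
        exact (inl_mem_liftSubgroup rfl).2 hu
      · rw [← inl_mem_liftSubgroup (s := generatorLift v) rfl, h]
        exact (inl_mem_liftSubgroup rfl).2 hu
    refine ⟨hW, generatorLift_mem_liftSubgroup.1 ?_⟩
    rw [← h]
    exact self_mem_liftSubgroup _ _
  · rintro ⟨rfl, h⟩
    have hs := generatorLift_mem_liftSubgroup.2 h
    rw [← liftSubgroup_traceSubmodule (liftSubgroup W (generatorLift v')) rfl hs]
    congr 1
    exact le_antisymm
      (subgroupOfSubmodule_le_iff.1 fun u hu => (inl_mem_liftSubgroup rfl).2 hu)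
      (subgroupOfSubmodule_le_iff.1 fun u hu => (inl_mem_liftSubgroup rfl).1 hu)

/-- A maximal subgroup not containing `N` contains a lift of the generator of `ℤ`. -/
theorem exists_generatorLift_mem {H : Subgroup (N ⋊[φ] Multiplicative ℤ)} (hH : IsCoatom H)
    (hN : ¬ (inl (φ := φ)).range ≤ H) : ∃ v, generatorLift v ∈ H := by
  have hnormal : (inl (φ := φ)).range.Normal := by
    rw [range_inl_eq_ker_rightHom]; infer_instance
  have htop : (inl (φ := φ)).range ⊔ H = ⊤ :=
    (hH.2 _ (lt_of_le_of_ne le_sup_right fun h => hN (h ▸ le_sup_left)))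
  have hmem : (generatorLift (φ := φ) 0) ∈ (inl (φ := φ)).range ⊔ H := htop ▸ Subgroup.mem_top _
  rw [← SetLike.mem_coe, Subgroup.normal_mul, Set.mem_mul] at hmem
  obtain ⟨_, ⟨u, rfl⟩, h, hh, heq⟩ := hmem
  refine ⟨toIntegralModule φ (Additive.ofMul u⁻¹), ?_⟩
  have : h = generatorLift (toIntegralModule φ (Additive.ofMul u⁻¹)) := by
    rw [← eq_inv_mul_iff_mul_eq] at heq
    rw [heq]
    ext
    · simp [generatorLift]
    · simp [generatorLift]
  rw [← this]
  exact hh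

variable (φ) in
/-- The maximal subgroups of index `n` not containing `N` are parametrised by a maximal submodule
`W` of index `n` and a class in `N / W`. -/
theorem ncard_maximal_not_containing {n : ℕ} (hn : n ≠ 0) :
    {H : Subgroup (N ⋊[φ] Multiplicative ℤ) |
        (IsCoatom H ∧ H.index = n) ∧ ¬ (inl (φ := φ)).range ≤ H}.ncard =
      maxSubmoduleCount ℤ[T;T⁻¹] (IntegralModule φ) n * n := by
  set A := {W : Submodule ℤ[T;T⁻¹] (IntegralModule φ) |
        IsCoatom W ∧ Nat.card (IntegralModule φ ⧸ W) = n}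
  have e1 : (Σ W : A, IntegralModule φ ⧸ W.1) ≃ A × Fin n :=
    (Equiv.sigmaCongrRight fun W => by
      have : Finite (IntegralModule φ ⧸ W.1) :=
        Nat.finite_of_card_ne_zero (by rw [W.2.2]; exact hn)
      exact (Finite.equivFin _).trans (finCongr W.2.2)).trans (Equiv.sigmaEquivProd _ _)
  have e2 : A.ncard * n = Nat.card (Σ W : A, IntegralModule φ ⧸ W.1) := by
    rw [Nat.card_congr e1, Nat.card_prod, Nat.card_fin, Nat.card_coe_set_eq]
  rw [maxSubmoduleCount, e2, ← Nat.card_coe_set_eq]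
  symm
  refine Nat.card_congr (Equiv.ofBijective
    (fun x => ⟨liftSubgroup x.1.1 (generatorLift x.2.out), ⟨?_, ?_⟩, ?_⟩) ⟨?_, ?_⟩)
  · exact (isCoatom_liftSubgroup rfl).2 x.1.2.1
  · rw [index_liftSubgroup _ rfl]; exact x.1.2.2
  · intro hle
    refine x.1.2.1.1 (eq_top_iff.2 (subgroupOfSubmodule_le_iff.1 fun u _ => ?_))
    exact (inl_mem_liftSubgroup rfl).1 (hle ⟨u, rfl⟩)
  · rintro ⟨⟨W, hW⟩, q⟩ ⟨⟨W', hW'⟩, q'⟩ h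
    obtain ⟨h1, h2⟩ := liftSubgroup_eq_iff.1 (congrArg Subtype.val h)
    dsimp only at h1
    subst h1
    have : q = q' := by
      rw [← Quotient.out_eq q, ← Quotient.out_eq q']
      exact (Submodule.Quotient.eq W).2 h2
    rw [this]
  · rintro ⟨H, ⟨hH, hidx⟩, hN⟩
    obtain ⟨v, hv⟩ := exists_generatorLift_mem hH hN
    have hlift := liftSubgroup_traceSubmodule H rfl hv
    set W := traceSubmodule H rfl hv
    refine ⟨⟨⟨W, ?_, ?_⟩, Submodule.Quotient.mk v⟩, Subtype.ext ?_⟩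
    · rw [← isCoatom_liftSubgroup (s := generatorLift v) rfl, hlift]; exact hH
    · rw [← index_liftSubgroup W (s := generatorLift v) rfl, hlift]; exact hidx
    · refine Eq.trans (liftSubgroup_eq_iff.2 ⟨rfl, ?_⟩) hlift
      exact (Submodule.Quotient.eq W).1 (Quotient.out_eq (Submodule.Quotient.mk v : _ ⧸ W))

theorem subgroup_multiplicative_int_eq_of_index_eq {H K : Subgroup (Multiplicative ℤ)}
    (h : H.index = K.index) : H = K := by
  have key : ∀ H : Subgroup (Multiplicative ℤ),
      Subgroup.toAddSubgroup' H = AddSubgroup.zmultiples (H.index : ℤ) := by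
    intro H
    obtain ⟨a, ha⟩ := Int.subgroup_cyclic (Subgroup.toAddSubgroup' H)
    have hi : H.index = a.natAbs := by
      rw [← Int.index_zmultiples, ← AddSubgroup.zmultiples_eq_closure] at *
      rw [← ha]; rfl
    rw [ha, hi, ← AddSubgroup.zmultiples_eq_closure, Int.zmultiples_natAbs]
  apply Subgroup.toAddSubgroup'.injective
  rw [key, key, h]

variable (φ) in
theorem subsingleton_maximal_containing (n : ℕ) :
    {H : Subgroup (N ⋊[φ] Multiplicative ℤ) |
        (IsCoatom H ∧ H.index = n) ∧ (inl (φ := φ)).range ≤ H}.Subsingleton := by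
  rintro H ⟨⟨-, hH⟩, hNH⟩ K ⟨⟨-, hK⟩, hNK⟩
  rw [range_inl_eq_ker_rightHom] at hNH hNK
  rw [← Subgroup.comap_map_eq_self hNH, ← Subgroup.comap_map_eq_self hNK]
  congr 1
  apply subgroup_multiplicative_int_eq_of_index_eq
  rw [Subgroup.index_map_eq _ rightHom_surjective hNH, hH,
    Subgroup.index_map_eq _ rightHom_surjective hNK, hK]

variable (φ) in
theorem maxSubgroupCount_le {n : ℕ} (hn : n ≠ 0) :
    maxSubgroupCount (N ⋊[φ] Multiplicative ℤ) n ≤ 1 +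
      maxSubmoduleCount ℤ[T;T⁻¹] (IntegralModule φ) n * n := by
  rw [← ncard_maximal_not_containing φ hn, maxSubgroupCount,
    ← Set.inter_union_compl {H | IsCoatom H ∧ H.index = n} {H | (inl (φ := φ)).range ≤ H}]
  refine (Set.ncard_union_le _ _).trans (Nat.add_le_add_right ?_ _)
  have := (subsingleton_maximal_containing φ n).finite.to_subtype
  exact (Set.ncard_le_one_iff_subsingleton (s := {H : Subgroup (N ⋊[φ] Multiplicative ℤ) |
    (IsCoatom H ∧ H.index = n) ∧ (inl (φ := φ)).range ≤ H})).2 (subsingleton_maximal_containing φ n)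

variable (φ) in
theorem le_maxSubgroupCount {n : ℕ} (hn : n ≠ 0) :
    maxSubmoduleCount ℤ[T;T⁻¹] (IntegralModule φ) n * n ≤
      maxSubgroupCount (N ⋊[φ] Multiplicative ℤ) n := by
  rw [← ncard_maximal_not_containing φ hn]
  -- a positive `ncard` certifies that the set is finite
  rcases Nat.eq_zero_or_pos ({H : Subgroup (N ⋊[φ] Multiplicative ℤ) |
        (IsCoatom H ∧ H.index = n) ∧ ¬ (inl (φ := φ)).range ≤ H}.ncard) with h0 | h0
  · rw [h0]; exact Nat.zero_le _
  · refine Set.ncard_le_ncard (fun H hH => hH.1) ?_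
    refine ((subsingleton_maximal_containing φ n).finite.union
      (Set.finite_of_ncard_pos h0)).subset ?_
    intro H hH
    by_cases h : (inl (φ := φ)).range ≤ H
    exacts [Or.inl ⟨hH, h⟩, Or.inr ⟨hH, h⟩]

/-- If `N ⋊ ℤ` is finitely generated then `N` is a finitely generated module. -/
theorem finite_integralModule (hG : Group.FG (N ⋊[φ] Multiplicative ℤ)) :
    Module.Finite ℤ[T;T⁻¹] (IntegralModule φ) := by
  classical
  obtain ⟨S, hS⟩ := (Group.fg_def.1 hG)
  refine ⟨⟨(S.image fun g => toIntegralModule φ (Additive.ofMul g.left)), ?_⟩⟩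
  set P := Submodule.span ℤ[T;T⁻¹]
    ((S.image fun g => toIntegralModule φ (Additive.ofMul g.left) : Finset _) :
      Set (IntegralModule φ))
  have htop : liftSubgroup P (generatorLift 0) = ⊤ := by
    rw [← top_le_iff, ← hS, Subgroup.closure_le]
    intro g hg
    refine ⟨g.left, mem_subgroupOfSubmodule.2 <| Submodule.subset_span
      (Finset.mem_coe.2 (Finset.mem_image_of_mem _ hg)), g.right.toAdd, ?_⟩
    have : generatorLift (φ := φ) 0 = inr (Multiplicative.ofAdd 1) := rfl
    rw [this, ← map_zpow, ← ofAdd_zsmul, smul_eq_mul, mul_one, ofAdd_toAdd, inl_left_mul_inr_right]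
  rw [eq_top_iff]
  refine subgroupOfSubmodule_le_iff.1 fun u _ => ?_
  rw [← inl_mem_liftSubgroup (s := generatorLift 0) rfl, htop]
  exact Subgroup.mem_top _

end SemidirectProduct

/-! ### Counting maximal submodules by semilinear maps to a finite field -/

section Counting

variable {R V F : Type*} [CommRing R] [AddCommGroup V] [Module R V] [Field F]

theorem isCoatom_ker_of_surjective {l : R →+* F} (hl : Function.Surjective l)
    {f : V →ₛₗ[l] F} (hf : f ≠ 0) :
    Function.Surjective f ∧ IsCoatom (LinearMap.ker f) := by
  obtain ⟨v, hv⟩ : ∃ v, f v ≠ 0 := by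
    by_contra! h
    exact hf (LinearMap.ext h)
  have hsurj : ∀ w, f w ≠ 0 → ∀ y, ∃ r : R, f (r • w) = y := fun w hw y => by
    obtain ⟨r, hr⟩ := hl (y / f w)
    exact ⟨r, by rw [f.map_smulₛₗ, hr, smul_eq_mul, div_mul_cancel₀ _ hw]⟩
  refine ⟨fun y => (hsurj v hv y).imp' (· • v) fun _ h => h, ?_, ?_⟩
  · intro h
    exact hv (LinearMap.mem_ker.1 (h ▸ Submodule.mem_top))
  · intro W hW
    obtain ⟨w, hw, hwk⟩ := SetLike.exists_of_lt hW
    rw [eq_top_iff]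
    intro y _
    obtain ⟨r, hr⟩ := hsurj w hwk (f y)
    have hk : y - r • w ∈ LinearMap.ker f := by rw [LinearMap.mem_ker, map_sub, hr, sub_self]
    have := W.add_mem (hW.le hk) (W.smul_mem r hw)
    rwa [sub_add_cancel] at this

theorem card_quotient_ker_of_surjective {l : R →+* F} {f : V →ₛₗ[l] F}
    (hf : Function.Surjective f) : Nat.card (V ⧸ LinearMap.ker f) = Nat.card F := by
  refine Nat.card_congr (Equiv.ofBijective
    (Quotient.lift f fun a b hab => ?_) ⟨?_, fun y => ?_⟩)
  · have : a - b ∈ LinearMap.ker f := (Submodule.quotientRel_def _).1 hab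
    rwa [LinearMap.mem_ker, map_sub, sub_eq_zero] at this
  · rintro ⟨a⟩ ⟨b⟩ hab
    refine (Submodule.Quotient.eq (LinearMap.ker f)).2 ?_
    rw [LinearMap.mem_ker, map_sub, sub_eq_zero]
    exact hab
  · obtain ⟨v, rfl⟩ := hf y
    exact ⟨Quotient.mk _ v, rfl⟩

/-- The kernel of a surjective semilinear map determines that of the ring homomorphism. -/
theorem map_eq_zero_iff_forall_smul_mem {l : R →+* F} {f : V →ₛₗ[l] F}
    (hf : Function.Surjective f) (r : R) : l r = 0 ↔ ∀ v, r • v ∈ LinearMap.ker f := by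
  constructor
  · intro h v
    rw [LinearMap.mem_ker, f.map_smulₛₗ, h, zero_smul]
  · intro h
    obtain ⟨v, hv⟩ := hf 1
    simpa [hv] using h v

/-- A maximal submodule whose quotient has as many elements as the finite field `F` is the kernel
of a semilinear map to `F`. -/
theorem exists_ker_eq_of_isCoatom [Finite F] {W : Submodule R V} (hW : IsCoatom W)
    (hcard : Nat.card (V ⧸ W) = Nat.card F) :
    ∃ (l : R →+* F) (f : V →ₛₗ[l] F), Function.Surjective l ∧ f ≠ 0 ∧ LinearMap.ker f = W := by
  have hs : IsSimpleModule R (V ⧸ W) := isSimpleModule_iff_isCoatom.2 hW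
  obtain ⟨m, hm, ⟨e⟩⟩ := isSimpleModule_iff_quot_maximal.1 hs
  let _ : Field (R ⧸ m) := Ideal.Quotient.field m
  have hc : Nat.card (R ⧸ m) = Nat.card F := by rw [← hcard]; exact (Nat.card_congr e.toEquiv).symm
  have : Finite (R ⧸ m) := Nat.finite_of_card_ne_zero (by rw [hc]; exact Nat.card_pos.ne')
  let _ := Fintype.ofFinite (R ⧸ m)
  let _ := Fintype.ofFinite F
  let σ : (R ⧸ m) ≃+* F := FiniteField.ringEquivOfCardEq
    (by rw [← Nat.card_eq_fintype_card, ← Nat.card_eq_fintype_card, hc])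
  let l : R →+* F := (σ : (R ⧸ m) →+* F).comp (Ideal.Quotient.mk m)
  let f : V →ₛₗ[l] F :=
    { toFun := fun v => σ (e (W.mkQ v))
      map_add' := fun x y => by simp
      map_smul' := fun r x => by
        rw [map_smul, map_smul, Algebra.smul_def, map_mul]
        rfl }
  have hker : LinearMap.ker f = W := by
    ext v
    rw [LinearMap.mem_ker]
    change σ (e (W.mkQ v)) = 0 ↔ _
    rw [map_eq_zero_iff σ σ.injective, LinearEquiv.map_eq_zero_iff, Submodule.mkQ_apply,
      Submodule.Quotient.mk_eq_zero]
  refine ⟨l, f, σ.surjective.comp Ideal.Quotient.mk_surjective, fun h0 => hW.1 ?_, hker⟩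
  rw [← hker, h0, LinearMap.ker_zero]

theorem isPrimePow_of_isCoatom {W : Submodule R V} (hW : IsCoatom W)
    (h0 : Nat.card (V ⧸ W) ≠ 0) : IsPrimePow (Nat.card (V ⧸ W)) := by
  have hs : IsSimpleModule R (V ⧸ W) := isSimpleModule_iff_isCoatom.2 hW
  obtain ⟨m, hm, ⟨e⟩⟩ := isSimpleModule_iff_quot_maximal.1 hs
  let _ : Field (R ⧸ m) := Ideal.Quotient.field m
  have hc : Nat.card (V ⧸ W) = Nat.card (R ⧸ m) := Nat.card_congr e.toEquiv
  rw [hc] at h0 ⊢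
  have : Finite (R ⧸ m) := Nat.finite_of_card_ne_zero h0
  let _ := Fintype.ofFinite (R ⧸ m)
  rw [Nat.card_eq_fintype_card]
  exact FiniteField.isPrimePow_card _

variable (R V F) in
/-- The pairs of a surjective ring homomorphism to `F` and a nonzero semilinear map along it. -/
abbrev SemilinearPair : Type _ :=
  Σ l : {l : R →+* F // Function.Surjective l}, {f : V →ₛₗ[l.1] F // f ≠ 0}

/-- Twisting a pair by an automorphism of `F` and rescaling by a nonzero element of `F`. -/
def SemilinearPair.twist (x : SemilinearPair R V F) (a : (F ≃+* F) × Fˣ) :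
    SemilinearPair R V F :=
  ⟨⟨(a.1 : F →+* F).comp x.1.1, a.1.surjective.comp x.1.2⟩,
    ⟨{ toFun := fun v => a.2 * a.1 (x.2.1 v)
       map_add' := fun v w => by rw [map_add, map_add, mul_add]
       map_smul' := fun r v => by
        rw [LinearMap.map_smulₛₗ, smul_eq_mul, map_mul, smul_eq_mul]
        change _ = a.1 (x.1.1 r) * _
        ring },
      fun h => x.2.2 (LinearMap.ext fun v => by
        have : a.2 * a.1 (x.2.1 v) = 0 := LinearMap.congr_fun h v
        simpa using this)⟩⟩

theorem SemilinearPair.ext_iff' {x y : SemilinearPair R V F} :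
    x = y ↔ x.1.1 = y.1.1 ∧ ∀ v, x.2.1 v = y.2.1 v := by
  constructor
  · rintro rfl
    exact ⟨rfl, fun _ => rfl⟩
  · obtain ⟨⟨l, hl⟩, ⟨f, hf⟩⟩ := x
    obtain ⟨⟨l', hl'⟩, ⟨f', hf'⟩⟩ := y
    rintro ⟨h1, h2⟩
    dsimp only at h1 h2
    subst h1
    have : f = f' := LinearMap.ext h2
    subst this
    rfl

/-- Two pairs have the same kernel exactly when they differ by a unique twist. -/
theorem SemilinearPair.bijective_twist [Finite F] (x : SemilinearPair R V F) :
    Function.Bijective (fun a : (F ≃+* F) × Fˣ =>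
      (⟨x.twist a, by
        ext v
        simp only [LinearMap.mem_ker]
        change a.2 * a.1 (x.2.1 v) = 0 ↔ _
        simp⟩ : {y : SemilinearPair R V F // LinearMap.ker y.2.1 = LinearMap.ker x.2.1})) := by
  have hx := (isCoatom_ker_of_surjective x.1.2 x.2.2).1
  constructor
  · rintro ⟨σ, c⟩ ⟨σ', c'⟩ h
    have h1 := (SemilinearPair.ext_iff'.1 (congrArg Subtype.val h)).2
    have h2 : ∀ y, (c : F) * σ y = c' * σ' y := fun y => by
      obtain ⟨v, rfl⟩ := hx y
      exact h1 v
    have hc : c = c' := Units.ext (by simpa using h2 1)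
    subst hc
    have hσ : σ = σ' := RingEquiv.ext fun y => mul_left_cancel₀ c.ne_zero (h2 y)
    rw [hσ]
  · rintro ⟨y, hy⟩
    have hys := (isCoatom_ker_of_surjective y.1.2 y.2.2).1
    have hker : ∀ r, x.1.1 r = 0 → y.1.1 r = 0 := fun r hr => by
      rw [map_eq_zero_iff_forall_smul_mem hys, hy]
      exact (map_eq_zero_iff_forall_smul_mem hx r).1 hr
    let σ₀ : F →+* F := RingHom.liftOfSurjective x.1.1 x.1.2
      ⟨y.1.1, fun r hr => RingHom.mem_ker.2 (hker r (RingHom.mem_ker.1 hr))⟩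
    have hσ₀ : ∀ r, σ₀ (x.1.1 r) = y.1.1 r := fun r =>
      RingHom.liftOfRightInverse_comp_apply _ _ _ _ _
    let σ : F ≃+* F := RingEquiv.ofBijective σ₀ (Finite.injective_iff_bijective.1 σ₀.injective)
    obtain ⟨v₀, hv₀⟩ := hx 1
    have hc : y.2.1 v₀ ≠ 0 := fun h => by
      have : v₀ ∈ LinearMap.ker x.2.1 := hy ▸ LinearMap.mem_ker.2 h
      rw [LinearMap.mem_ker, hv₀] at this
      exact one_ne_zero this
    refine ⟨(σ, Units.mk0 _ hc), Subtype.ext (SemilinearPair.ext_iff'.2 ⟨?_, fun v => ?_⟩)⟩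
    · ext r
      exact hσ₀ r
    · change y.2.1 v₀ * σ₀ (x.2.1 v) = y.2.1 v
      obtain ⟨r, hr⟩ := x.1.2 (x.2.1 v)
      have hmem : v - r • v₀ ∈ LinearMap.ker y.2.1 := by
        rw [hy, LinearMap.mem_ker, map_sub, LinearMap.map_smulₛₗ, hr, hv₀]
        simp
      rw [LinearMap.mem_ker, map_sub, LinearMap.map_smulₛₗ, sub_eq_zero] at hmem
      rw [hmem, ← hr, hσ₀, smul_eq_mul, mul_comm]

theorem card_ringEquiv_eq {p k : ℕ} [Finite F] [CharP F p] [Fact p.Prime]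
    (hF : Nat.card F = p ^ k) : Nat.card (F ≃+* F) = k := by
  let _ := ZMod.algebra F p
  let _ := Fintype.ofFinite F
  have hfin : Module.Finite (ZMod p) F := Module.Finite.of_finite
  have h1 : Module.finrank (ZMod p) F = k := by
    have h := Module.natCard_eq_pow_finrank (K := ZMod p) (V := F)
    rw [hF, Nat.card_zmod] at h
    exact (Nat.pow_right_injective (Fact.out : p.Prime).two_le h).symm
  rw [← h1, ← IsGalois.card_aut_eq_finrank (ZMod p) F]
  refine Nat.card_congr ⟨fun σ => AlgEquiv.ofRingEquiv (f := σ) fun r => ?_,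
    fun σ => σ.toRingEquiv, fun _ => rfl, fun _ => rfl⟩
  exact RingHom.congr_fun (Subsingleton.elim ((σ : F →+* F).comp (algebraMap (ZMod p) F))
    (algebraMap (ZMod p) F)) r

/-- Counting pairs by their kernels: the pairs with a given kernel are permuted simply transitively
by the automorphisms and the nonzero scalars of `F`. -/
theorem card_semilinearPair {p k : ℕ} [Finite F] [CharP F p] [Fact p.Prime]
    (hF : Nat.card F = p ^ k) :
    Nat.card (SemilinearPair R V F) =
      maxSubmoduleCount R V (p ^ k) * (k * (p ^ k - 1)) := by
  set A := {W : Submodule R V | IsCoatom W ∧ Nat.card (V ⧸ W) = p ^ k} with hA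
  let κ : SemilinearPair R V F → A := fun x =>
    ⟨LinearMap.ker x.2.1, (isCoatom_ker_of_surjective x.1.2 x.2.2).2, by
      rw [card_quotient_ker_of_surjective (isCoatom_ker_of_surjective x.1.2 x.2.2).1, hF]⟩
  have hfib : ∀ W : A, Nonempty ({x // κ x = W} ≃ (F ≃+* F) × Fˣ) := by
    rintro ⟨W, hW, hc⟩
    obtain ⟨l, f, hl, hf, rfl⟩ := exists_ker_eq_of_isCoatom (F := F) hW (hc.trans hF.symm)
    let x : SemilinearPair R V F := ⟨⟨l, hl⟩, ⟨f, hf⟩⟩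
    exact ⟨(Equiv.subtypeEquivRight fun y => Subtype.ext_iff).trans
      (Equiv.ofBijective _ x.bijective_twist).symm⟩
  have e : SemilinearPair R V F ≃ A × ((F ≃+* F) × Fˣ) :=
    (Equiv.sigmaFiberEquiv κ).symm.trans
      ((Equiv.sigmaCongrRight fun W => (hfib W).some).trans (Equiv.sigmaEquivProd _ _))
  rw [Nat.card_congr e, Nat.card_prod, Nat.card_prod, card_ringEquiv_eq hF, Nat.card_units, hF,
    Nat.card_coe_set_eq]
  rfl

/-- The dimension over `F` of the space of semilinear maps along `l`. -/
noncomputable def homDim (V : Type*) [AddCommGroup V] [Module R V] (l : R →+* F) : ℕ :=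
  Module.finrank F (V →ₛₗ[l] F)

/-- Semilinear maps are determined by their values on generators. -/
theorem injective_eval_of_span {ι : Type*} (l : R →+* F) (v : ι → V) (B : R) (hB : l B ≠ 0)
    (K : Submodule R V) (hK : ∀ (f : V →ₛₗ[l] F), ∀ w ∈ K, f w = 0)
    (h : ∀ w, B • w ∈ Submodule.span R (Set.range v) ⊔ K) :
    Function.Injective (LinearMap.pi (R := F) (φ := fun _ : ι => F) fun i =>
      ({ toFun := fun f => f (v i), map_add' := fun _ _ => rfl, map_smul' := fun _ _ => rfl } :
        (V →ₛₗ[l] F) →ₗ[F] F)) := by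
  rw [← LinearMap.ker_eq_bot, LinearMap.ker_eq_bot']
  intro f hf
  ext w
  have hle : Submodule.span R (Set.range v) ⊔ K ≤ LinearMap.ker f := by
    refine sup_le (Submodule.span_le.2 ?_) (hK f)
    rintro _ ⟨i, rfl⟩
    exact congrFun hf i
  have := hle (h w)
  rw [LinearMap.mem_ker, LinearMap.map_smulₛₗ, smul_eq_mul] at this
  exact (mul_eq_zero.1 this).resolve_left hB

/-- The dimension is at most the number of generators of a submodule that, together with a submodule
`K` on which semilinear maps vanish, contains a multiple `B • V` with `l B ≠ 0`. -/
theorem homDim_le {ι : Type*} [Fintype ι] (l : R →+* F) (v : ι → V) (B : R) (hB : l B ≠ 0)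
    (K : Submodule R V) (hK : ∀ (f : V →ₛₗ[l] F), ∀ w ∈ K, f w = 0)
    (h : ∀ w, B • w ∈ Submodule.span R (Set.range v) ⊔ K) :
    homDim V l ≤ Fintype.card ι := by
  have := LinearMap.finrank_le_finrank_of_injective (injective_eval_of_span l v B hB K hK h)
  rwa [Module.finrank_fintype_fun_eq_card] at this

variable (V) in
theorem finite_semilinearMap [Module.Finite R V] (l : R →+* F) : Module.Finite F (V →ₛₗ[l] F) := by
  obtain ⟨n, v, hv⟩ := Module.Finite.exists_fin (R := R) (M := V)
  exact Module.Finite.of_injective _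
    (injective_eval_of_span l v 1 (by simp) ⊥ (by simp) (by simp [hv]))

/-- If `V / K` is almost free on the classes of the `v i`, modulo an ideal killed by `l`, the
coordinate functions give independent semilinear maps. -/
theorem le_homDim [Module.Finite R V] {ι : Type*} [Fintype ι] (l : R →+* F) (v : ι → V) (B : R)
    (hB : l B ≠ 0) (K : Submodule R V) (I : Ideal R) (hI : ∀ a ∈ I, l a = 0)
    (h : ∀ w, B • w ∈ Submodule.span R (Set.range v) ⊔ K)
    (hind : ∀ c : ι → R, ∑ i, c i • v i ∈ K → ∀ i, c i ∈ I) :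
    Fintype.card ι ≤ homDim V l := by
  classical
  have hex : ∀ w, ∃ c : ι → R, B • w - ∑ i, c i • v i ∈ K := fun w => by
    obtain ⟨y, hy, z, hz, hyz⟩ := Submodule.mem_sup.1 (h w)
    obtain ⟨c, rfl⟩ := (Submodule.mem_span_range_iff_exists_fun R).1 hy
    exact ⟨c, by rw [← hyz, add_sub_cancel_left]; exact hz⟩
  choose c hc using hex
  have huniq : ∀ w (c' : ι → R), B • w - ∑ i, c' i • v i ∈ K → ∀ i, l (c w i) = l (c' i) := by
    intro w c' hc' i
    have h1 := K.sub_mem hc' (hc w)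
    rw [sub_sub_sub_cancel_left, ← Finset.sum_sub_distrib] at h1
    simp_rw [← sub_smul] at h1
    have := hI _ (hind _ h1 i)
    rwa [map_sub, sub_eq_zero] at this
  let f : ι → (V →ₛₗ[l] F) := fun i =>
    { toFun := fun w => l (c w i)
      map_add' := fun x y => by
        rw [huniq (x + y) (c x + c y), Pi.add_apply, map_add]
        convert K.add_mem (hc x) (hc y) using 1
        simp only [smul_add, Pi.add_apply, add_smul, Finset.sum_add_distrib]
        abel
      map_smul' := fun r x => by
        rw [huniq (r • x) (r • c x), Pi.smul_apply, smul_eq_mul, map_mul, smul_eq_mul]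
        convert K.smul_mem r (hc x) using 1
        simp only [smul_sub, Finset.smul_sum, Pi.smul_apply, smul_assoc]
        rw [smul_comm] }
  have hf : ∀ i j, f i (v j) = if i = j then l B else 0 := fun i j => by
    change l (c (v j) i) = _
    rw [huniq (v j) (Pi.single j B)]
    · rw [Pi.single_apply]; split_ifs <;> simp
    · simp [Pi.single_apply, ite_smul]
  have hli : LinearIndependent F f := by
    rw [Fintype.linearIndependent_iff]
    intro g hg j
    have := LinearMap.congr_fun hg (v j)
    rw [LinearMap.sum_apply] at this
    simp only [LinearMap.smul_apply, hf, smul_eq_mul, mul_ite, mul_zero, Finset.sum_ite_eq',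
      Finset.mem_univ, if_true, LinearMap.zero_apply] at this
    exact (mul_eq_zero.1 this).resolve_right hB
  have := finite_semilinearMap V l
  exact hli.fintype_card_le_finrank

/-- The number of maximal submodules of index `p ^ k`, in terms of the dimensions `homDim`. -/
theorem maxSubmoduleCount_mul_eq {p k : ℕ} [Finite F] [CharP F p] [Fact p.Prime]
    (hF : Nat.card F = p ^ k) [Module.Finite R V]
    [Fintype {l : R →+* F // Function.Surjective l}] :
    maxSubmoduleCount R V (p ^ k) * (k * (p ^ k - 1)) =
      ∑ l : {l : R →+* F // Function.Surjective l}, ((p ^ k) ^ homDim V l.1 - 1) := by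
  have hfin (l : R →+* F) : Finite (V →ₛₗ[l] F) := by
    have := finite_semilinearMap V l
    exact Module.finite_of_finite F
  rw [← card_semilinearPair hF, Nat.card_sigma]
  refine Finset.sum_congr rfl fun l _ => ?_
  have := finite_semilinearMap V l.1
  rw [homDim, ← hF, ← Module.natCard_eq_pow_finrank]
  classical
  have h1 := Nat.card_congr (Equiv.optionSubtypeNe (0 : V →ₛₗ[l.1] F))
  rw [Finite.card_option] at h1
  rw [← h1, Nat.add_sub_cancel]

end Counting

/-! ### Homomorphisms from `ℤ[x, x⁻¹]` to finite fields -/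

section LaurentHom

open LaurentPolynomial

theorem laurent_ringHom_ext {S : Type*} [CommRing S] {f g : ℤ[T;T⁻¹] →+* S}
    (h : f (T 1) = g (T 1)) : f = g := by
  refine IsLocalization.ringHom_ext (Submonoid.powers (Polynomial.X : ℤ[X])) ?_
  refine Polynomial.ringHom_ext (fun a => ?_) ?_
  · simp
  · simpa using h

theorem T_one_map_ne_zero {F : Type*} [Field F] (l : ℤ[T;T⁻¹] →+* F) : l (T 1) ≠ 0 :=
  ((isUnit_T 1).map l).ne_zero

theorem map_toLaurent {F : Type*} [Field F] (l : ℤ[T;T⁻¹] →+* F) (P : ℤ[X]) :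
    l (Polynomial.toLaurent P) = P.eval₂ (Int.castRingHom F) (l (T 1)) := by
  have : l.comp (Polynomial.toLaurent : ℤ[X] →+* ℤ[T;T⁻¹]) =
      Polynomial.eval₂RingHom (Int.castRingHom F) (l (T 1)) :=
    Polynomial.ringHom_ext (by simp) (by simp)
  exact RingHom.congr_fun this P

/-- Ring homomorphisms from `ℤ[x, x⁻¹]` to a field correspond to nonzero elements. -/
noncomputable def laurentHomEquiv (F : Type*) [Field F] : (ℤ[T;T⁻¹] →+* F) ≃ Fˣ where
  toFun l := Units.mk0 (l (T 1)) (T_one_map_ne_zero l)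
  invFun x := eval₂ (Int.castRingHom F) x
  left_inv l := laurent_ringHom_ext (by rw [eval₂_T]; simp)
  right_inv x := Units.ext (by simp [eval₂_T])

instance (F : Type*) [Field F] [Finite F] : Finite (ℤ[T;T⁻¹] →+* F) :=
  Finite.of_equiv _ (laurentHomEquiv F).symm

theorem card_laurentHom (F : Type*) [Field F] [Finite F] :
    Nat.card (ℤ[T;T⁻¹] →+* F) = Nat.card F - 1 := by
  rw [Nat.card_congr (laurentHomEquiv F), Nat.card_units]

theorem C_dvd_toLaurent_iff {p : ℤ} {P : ℤ[X]} :
    C p ∣ Polynomial.toLaurent P ↔ Polynomial.C p ∣ P := by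
  constructor
  · rintro ⟨B, hB⟩
    obtain ⟨m, Q, hQ⟩ := exists_T_pow B
    have h : P * Polynomial.X ^ m = Polynomial.C p * Q := by
      apply Polynomial.toLaurent_injective
      rw [map_mul, map_mul, hB, hQ, Polynomial.toLaurent_C, Polynomial.toLaurent_X_pow, mul_assoc]
    rw [Polynomial.C_dvd_iff_dvd_coeff] at *
    intro i
    rw [← Polynomial.coeff_mul_X_pow P m i, h, Polynomial.coeff_C_mul]
    exact dvd_mul_right _ _
  · rintro ⟨Q, rfl⟩
    rw [map_mul, Polynomial.toLaurent_C]
    exact dvd_mul_right _ _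

theorem C_dvd_iff_of_eq_mul_T {p : ℤ} {A : ℤ[T;T⁻¹]} {P : ℤ[X]} {m : ℤ}
    (h : Polynomial.toLaurent P = A * T m) : C p ∣ A ↔ Polynomial.C p ∣ P := by
  rw [← C_dvd_toLaurent_iff, h, (isUnit_T m).dvd_mul_right]

theorem finite_setOf_C_dvd {A : ℤ[T;T⁻¹]} (hA : A ≠ 0) : {p : ℕ | C (p : ℤ) ∣ A}.Finite := by
  obtain ⟨m, P, hP⟩ := exists_T_pow A
  have hP0 : P ≠ 0 := by
    rintro rfl
    rw [map_zero] at hP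
    exact hA ((isUnit_T (m : ℤ)).mul_left_eq_zero.1 hP.symm)
  have hl := Polynomial.leadingCoeff_ne_zero.2 hP0
  refine (Set.finite_le_nat P.leadingCoeff.natAbs).subset fun p hp => ?_
  have h1 := (C_dvd_iff_of_eq_mul_T hP).1 hp
  rw [Polynomial.C_dvd_iff_dvd_coeff] at h1
  exact Nat.le_of_dvd (Int.natAbs_pos.2 hl) (Int.natCast_dvd.1 (h1 P.natDegree))

/-- A Laurent polynomial vanishes at boundedly many points of a field in whose characteristic it is
nonzero. -/
theorem exists_card_zero_le (A : ℤ[T;T⁻¹]) : ∃ D : ℕ, ∀ (p : ℕ), ¬ C (p : ℤ) ∣ A →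
    ∀ (F : Type) [Field F] [Finite F] [CharP F p],
      Nat.card {l : ℤ[T;T⁻¹] →+* F // l A = 0} ≤ D := by
  classical
  obtain ⟨m, P, hP⟩ := exists_T_pow A
  refine ⟨P.natDegree, fun p hp F _ _ _ => ?_⟩
  have hP0 : P.map (Int.castRingHom F) ≠ 0 := by
    intro h
    refine hp ((C_dvd_iff_of_eq_mul_T hP).2 (Polynomial.C_dvd_iff_dvd_coeff _ _ |>.2 fun i => ?_))
    rw [← CharP.intCast_eq_zero_iff F p]
    simpa using congrArg (fun Q => Q.coeff i) h
  let f : {l : ℤ[T;T⁻¹] →+* F // l A = 0} → (P.map (Int.castRingHom F)).roots.toFinset := fun l =>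
    ⟨l.1 (T 1), by
      rw [Multiset.mem_toFinset, Polynomial.mem_roots hP0, Polynomial.IsRoot.def,
        Polynomial.eval_map, ← map_toLaurent, hP, map_mul, l.2, zero_mul]⟩
  have hf : Function.Injective f := fun l l' h =>
    Subtype.ext (laurent_ringHom_ext (congrArg Subtype.val h))
  refine (Nat.card_le_card_of_injective f hf).trans ?_
  rw [Nat.card_eq_fintype_card, Fintype.card_coe]
  exact (Multiset.toFinset_card_le _).trans
    ((Polynomial.card_roots' _).trans Polynomial.natDegree_map_le)

/-- The points of a field of `p ^ k` elements that generate it come in Galois orbits of `k`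
elements. -/
theorem le_card_zero_of_surjective {F : Type*} [Field F] [Finite F] {p k : ℕ} [CharP F p]
    [Fact p.Prime] (hF : Nat.card F = p ^ k) {A : ℤ[T;T⁻¹]} {l : ℤ[T;T⁻¹] →+* F}
    (hl : Function.Surjective l) (hA : l A = 0) : k ≤ Nat.card {l : ℤ[T;T⁻¹] →+* F // l A = 0} := by
  rw [← card_ringEquiv_eq hF]
  refine Nat.card_le_card_of_injective
    (fun σ : F ≃+* F => ⟨(σ : F →+* F).comp l, by simp [hA]⟩) fun σ τ h => RingEquiv.ext fun y => ?_
  obtain ⟨r, rfl⟩ := hl y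
  exact RingHom.congr_fun (congrArg Subtype.val h) r

theorem card_surjective_of_card_eq_prime {F : Type*} [Field F] [Finite F] {p : ℕ}
    [Fact p.Prime] (hF : Nat.card F = p) :
    Nat.card {l : ℤ[T;T⁻¹] →+* F // Function.Surjective l} = p - 1 := by
  have hsurj : ∀ l : ℤ[T;T⁻¹] →+* F, Function.Surjective l := by
    intro l y
    have h1 : AddSubgroup.zmultiples (1 : F) = ⊤ := by
      rcases (AddSubgroup.zmultiples (1 : F)).eq_bot_or_eq_top_of_prime_card
        (hp := by rw [hF]; infer_instance) with h | h
      · exact absurd ((AddSubgroup.zmultiples_eq_bot).1 h) one_ne_zero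
      · exact h
    obtain ⟨z, hz⟩ := AddSubgroup.mem_zmultiples_iff.1 (h1 ▸ AddSubgroup.mem_top y)
    exact ⟨z, by simpa using hz⟩
  rw [Nat.card_congr (Equiv.subtypeUnivEquiv hsurj), card_laurentHom, hF]

theorem le_card_surjective_of_prime_exponent {F : Type*} [Field F] [Finite F] {p k : ℕ} [CharP F p]
    [Fact p.Prime] (hk : k.Prime) (hF : Nat.card F = p ^ k) :
    p ^ k - p ≤ Nat.card {l : ℤ[T;T⁻¹] →+* F // Function.Surjective l} := by
  classical
  let _ := ZMod.algebra F p
  let _ := Fintype.ofFinite F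
  have hfin : Module.Finite (ZMod p) F := Module.Finite.of_finite
  have hrank : Module.finrank (ZMod p) F = k := by
    have h := Module.natCard_eq_pow_finrank (K := ZMod p) (V := F)
    rw [hF, Nat.card_zmod] at h
    exact (Nat.pow_right_injective (Fact.out : p.Prime).two_le h).symm
  have := Subalgebra.isSimpleOrder_of_finrank_prime (ZMod p) F (hrank ▸ hk)
  let B : Set F := Set.range (algebraMap (ZMod p) F)
  have hB : Nat.card (Bᶜ : Set F) = p ^ k - p := by
    rw [Nat.card_coe_set_eq, Set.ncard_compl, hF, show B = Set.range _ from rfl, ← Set.image_univ,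
      Set.ncard_image_of_injective _ (algebraMap (ZMod p) F).injective, Set.ncard_univ,
      Nat.card_zmod]
  rw [← hB]
  have hne : ∀ x : (Bᶜ : Set F), x.1 ≠ 0 := fun x h => x.2 ⟨0, by rw [map_zero, h]⟩
  let f : (Bᶜ : Set F) → (ℤ[T;T⁻¹] →+* F) := fun x =>
    (laurentHomEquiv F).symm (Units.mk0 x.1 (hne x))
  have hfT : ∀ x, f x (T 1) = x.1 := fun x =>
    congrArg Units.val ((laurentHomEquiv F).apply_symm_apply (Units.mk0 x.1 (hne x)))
  refine Nat.card_le_card_of_injective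
    (fun x => (⟨f x, ?_⟩ : {l : ℤ[T;T⁻¹] →+* F // Function.Surjective l})) ?_
  · let S : Subalgebra (ZMod p) F :=
      { (f x).range with
        algebraMap_mem' := fun r => by
          obtain ⟨z, rfl⟩ := ZMod.intCast_surjective r
          exact ⟨(z : ℤ[T;T⁻¹]), by simp⟩ }
    have hS : S = ⊤ := by
      refine (eq_bot_or_eq_top S).resolve_left fun h => x.2 ?_
      have hx : x.1 ∈ S := ⟨T 1, hfT x⟩
      rw [h] at hx
      exact Algebra.mem_bot.1 hx
    intro y
    have hy : y ∈ S := hS ▸ Algebra.mem_top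
    exact hy
  · intro x y h
    have := RingHom.congr_fun (congrArg Subtype.val h) (T 1)
    dsimp only at this
    rw [hfT, hfT] at this
    exact Subtype.ext this

end LaurentHom

/-! ### Bounds for the number of maximal submodules in terms of dimensions -/

section Bounds

variable {R V F : Type*} [CommRing R] [AddCommGroup V] [Module R V] [Module.Finite R V]
  [Field F] [Finite F] {p k : ℕ} [CharP F p] [Fact p.Prime]

theorem maxSubmoduleCount_mul_le (hF : Nat.card F = p ^ k) [Finite (R →+* F)] {r d D M : ℕ} {A : R}
    (hM : Nat.card (R →+* F) ≤ M)
    (hD : Nat.card {l : R →+* F // l A = 0} ≤ D)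
    (hd : ∀ l : R →+* F, homDim V l ≤ d)
    (hr : ∀ l : R →+* F, l A ≠ 0 → homDim V l ≤ r) :
    maxSubmoduleCount R V (p ^ k) * (k * (p ^ k - 1)) ≤
      M * ((p ^ k) ^ r - 1) + D * ((p ^ k) ^ d - 1) := by
  classical
  let _ := Fintype.ofFinite (R →+* F)
  have hq : 0 < p ^ k := pow_pos (Fact.out : p.Prime).pos k
  have hmono : ∀ {i j : ℕ}, i ≤ j → (p ^ k) ^ i - 1 ≤ (p ^ k) ^ j - 1 := fun h =>
    Nat.sub_le_sub_right (Nat.pow_le_pow_right hq h) 1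
  rw [maxSubmoduleCount_mul_eq hF]
  calc ∑ l : {l : R →+* F // Function.Surjective l}, ((p ^ k) ^ homDim V l.1 - 1)
      ≤ ∑ l : R →+* F, ((p ^ k) ^ homDim V l - 1) := by
        rw [← Finset.sum_subtype (Finset.univ.filter fun l : R →+* F => Function.Surjective l)
          (by simp) fun l => (p ^ k) ^ homDim V l - 1]
        exact Finset.sum_le_sum_of_subset (Finset.filter_subset _ _)
    _ ≤ ∑ l : R →+* F, (((p ^ k) ^ r - 1) + if l A = 0 then ((p ^ k) ^ d - 1) else 0) := by
        refine Finset.sum_le_sum fun l _ => ?_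
        split_ifs with h
        · exact (hmono (hd l)).trans (Nat.le_add_left _ _)
        · exact hmono (hr l h)
    _ ≤ _ := by
        rw [Finset.sum_add_distrib, Finset.sum_const, smul_eq_mul, ← Finset.sum_filter,
          Finset.sum_const, smul_eq_mul, Finset.card_univ, ← Nat.card_eq_fintype_card,
          ← Fintype.card_subtype, ← Nat.card_eq_fintype_card]
        gcongr

theorem maxSubmoduleCount_mul_le_of_surjective (hF : Nat.card F = p ^ k) [Finite (R →+* F)]
    {r M : ℕ} (hM : Nat.card (R →+* F) ≤ M)
    (hr : ∀ l : R →+* F, Function.Surjective l → homDim V l ≤ r) :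
    maxSubmoduleCount R V (p ^ k) * (k * (p ^ k - 1)) ≤ M * ((p ^ k) ^ r - 1) := by
  classical
  let _ := Fintype.ofFinite (R →+* F)
  have hq : 0 < p ^ k := pow_pos (Fact.out : p.Prime).pos k
  rw [maxSubmoduleCount_mul_eq hF]
  refine (Finset.sum_le_card_nsmul _ _ ((p ^ k) ^ r - 1) fun l _ =>
    Nat.sub_le_sub_right (Nat.pow_le_pow_right hq (hr l.1 l.2)) 1).trans ?_
  rw [smul_eq_mul, Finset.card_univ, ← Nat.card_eq_fintype_card]
  exact Nat.mul_le_mul_right _ ((Finite.card_subtype_le _).trans hM)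

theorem le_maxSubmoduleCount_mul (hF : Nat.card F = p ^ k) [Finite (R →+* F)] {r M : ℕ}
    (hM : M ≤ Nat.card {l : R →+* F // Function.Surjective l})
    (hr : ∀ l : R →+* F, Function.Surjective l → r ≤ homDim V l) :
    M * ((p ^ k) ^ r - 1) ≤ maxSubmoduleCount R V (p ^ k) * (k * (p ^ k - 1)) := by
  classical
  let _ := Fintype.ofFinite (R →+* F)
  have hq : 0 < p ^ k := pow_pos (Fact.out : p.Prime).pos k
  rw [maxSubmoduleCount_mul_eq hF]
  refine le_trans ?_ (Finset.card_nsmul_le_sum _ _ ((p ^ k) ^ r - 1) fun l _ =>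
    Nat.sub_le_sub_right (Nat.pow_le_pow_right hq (hr l.1 l.2)) 1)
  rw [smul_eq_mul, Finset.card_univ, ← Nat.card_eq_fintype_card]
  exact Nat.mul_le_mul_right _ hM

theorem le_maxSubmoduleCount_mul_of_exists (hF : Nat.card F = p ^ k) [Finite (R →+* F)] {r : ℕ}
    (l : R →+* F) (hl : Function.Surjective l) (hr : r ≤ homDim V l) :
    (p ^ k) ^ r - 1 ≤ maxSubmoduleCount R V (p ^ k) * (k * (p ^ k - 1)) := by
  classical
  let _ := Fintype.ofFinite (R →+* F)
  have hq : 0 < p ^ k := pow_pos (Fact.out : p.Prime).pos k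
  rw [maxSubmoduleCount_mul_eq hF]
  exact (Nat.sub_le_sub_right (Nat.pow_le_pow_right hq hr) 1).trans
    (Finset.single_le_sum (f := fun l : {l : R →+* F // Function.Surjective l} =>
      (p ^ k) ^ homDim V l.1 - 1) (fun _ _ => Nat.zero_le _) (Finset.mem_univ ⟨l, hl⟩))

end Bounds

/-! ### The reduction modulo a prime -/

section ReductionModP

open LaurentPolynomial

variable {N : Type*} [CommGroup N] (φ : Multiplicative ℤ →* MulAut N) (p : ℕ)

/-- The reduction `N → N / pN`, with values in the `𝔽_p[x]`-module `N / pN`. -/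
noncomputable def reduction : IntegralModule φ →+ Module.AEval' (generatorActionModP φ p) :=
  ((Module.AEval'.of (generatorActionModP φ p)).toAddEquiv.toAddMonoidHom).comp
    ((QuotientAddGroup.mk' (nsmulAddMonoidHom (α := Additive N) p).range).comp
      (toIntegralModule φ).symm.toAddMonoidHom)

/-- The submodule `pN` of `N`. -/
noncomputable def multiples : Submodule ℤ[T;T⁻¹] (IntegralModule φ) :=
  LinearMap.range (LinearMap.lsmul ℤ[T;T⁻¹] (IntegralModule φ) (C (p : ℤ)))

theorem C_smul_integralModule (a : ℤ) (v : IntegralModule φ) :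
    (C a : ℤ[T;T⁻¹]) • v = a • v := LaurentModule.C_smul (generatorAction φ) a v

theorem reduction_surjective : Function.Surjective (reduction φ p) := by
  intro y
  obtain ⟨y, rfl⟩ := (Module.AEval'.of (generatorActionModP φ p)).surjective y
  obtain ⟨v, rfl⟩ := QuotientAddGroup.mk'_surjective _ y
  exact ⟨toIntegralModule φ v, rfl⟩

theorem reduction_eq_zero_iff {v : IntegralModule φ} :
    reduction φ p v = 0 ↔ v ∈ multiples φ p := by
  have h1 : reduction φ p v = 0 ↔
      (toIntegralModule φ).symm v ∈ (nsmulAddMonoidHom (α := Additive N) p).range :=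
    ((Module.AEval'.of (generatorActionModP φ p)).map_eq_zero_iff).trans
      (QuotientAddGroup.eq_zero_iff _)
  rw [h1]
  constructor
  · rintro ⟨w, hw⟩
    refine ⟨toIntegralModule φ w, ?_⟩
    rw [LinearMap.lsmul_apply, C_smul_integralModule, natCast_zsmul]
    exact hw
  · rintro ⟨w, hw⟩
    rw [LinearMap.lsmul_apply, C_smul_integralModule, natCast_zsmul] at hw
    exact ⟨w, hw⟩

theorem reduction_toLaurent_smul (P : ℤ[X]) (v : IntegralModule φ) :
    reduction φ p (Polynomial.toLaurent P • v) =
      P.map (Int.castRingHom (ZMod p)) • reduction φ p v := by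
  have hX : ∀ v, reduction φ p ((T 1 : ℤ[T;T⁻¹]) • v) =
      (Polynomial.X : (ZMod p)[X]) • reduction φ p v := by
    intro v
    have h : (T 1 : ℤ[T;T⁻¹]) • v =
        toIntegralModule φ (generatorAction φ ((toIntegralModule φ).symm v)) :=
      LaurentModule.T_one_smul (generatorAction φ) v
    rw [h]
    exact (Module.AEval'.X_smul_of (generatorActionModP φ p)
      (QuotientAddGroup.mk ((toIntegralModule φ).symm v))).symm
  induction P using Polynomial.induction_on generalizing v with
  | C a =>
    rw [Polynomial.toLaurent_C, C_smul_integralModule, map_zsmul, Polynomial.map_C]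
    simp [Int.cast_smul_eq_zsmul]
  | add P Q hP hQ => rw [map_add, add_smul, map_add, hP, hQ, Polynomial.map_add, add_smul]
  | monomial n a h =>
    rw [pow_succ, ← mul_assoc, map_mul, mul_smul, h, Polynomial.toLaurent_X, hX,
      Polynomial.map_mul (p := _ * _), Polynomial.map_X, mul_smul]

variable [Fact p.Prime]

variable {φ p} {m : ℕ} (gen : Fin m → IntegralModule φ) (s : Set (Fin m))

theorem exists_reduction_eq_of_mem_span {y : Module.AEval' (generatorActionModP φ p)}
    (hy : y ∈ Submodule.span (ZMod p)[X] ((fun i => reduction φ p (gen i)) '' s)) :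
    ∃ w ∈ Submodule.span ℤ[T;T⁻¹] (gen '' s), reduction φ p w = y := by
  induction hy using Submodule.span_induction with
  | mem y hy =>
    obtain ⟨i, hi, rfl⟩ := hy
    exact ⟨gen i, Submodule.subset_span ⟨i, hi, rfl⟩, rfl⟩
  | zero => exact ⟨0, Submodule.zero_mem _, map_zero _⟩
  | add x y _ _ hx hy =>
    obtain ⟨w, hw, rfl⟩ := hx
    obtain ⟨w', hw', rfl⟩ := hy
    exact ⟨w + w', Submodule.add_mem _ hw hw', map_add _ _ _⟩
  | smul P y _ hy =>
    obtain ⟨w, hw, rfl⟩ := hy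
    obtain ⟨Q, rfl⟩ := Polynomial.map_surjective _
      (ZMod.ringHom_surjective (Int.castRingHom (ZMod p))) P
    exact ⟨_, Submodule.smul_mem _ (Polynomial.toLaurent Q) hw, reduction_toLaurent_smul φ p Q w⟩

theorem exists_X_pow_smul_reduction_mem_span {u : IntegralModule φ}
    (hu : u ∈ Submodule.span ℤ[T;T⁻¹] (gen '' s)) :
    ∃ n : ℕ, (Polynomial.X ^ n : (ZMod p)[X]) • reduction φ p u ∈
      Submodule.span (ZMod p)[X] ((fun i => reduction φ p (gen i)) '' s) := by
  induction hu using Submodule.span_induction with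
  | mem y hy =>
    obtain ⟨i, hi, rfl⟩ := hy
    exact ⟨0, Submodule.smul_mem _ _ (Submodule.subset_span ⟨i, hi, rfl⟩)⟩
  | zero => exact ⟨0, by simp⟩
  | add x y _ _ hx hy =>
    obtain ⟨n, hn⟩ := hx
    obtain ⟨n', hn'⟩ := hy
    refine ⟨n + n', ?_⟩
    rw [map_add, smul_add]
    refine Submodule.add_mem _ ?_ ?_
    · rw [add_comm, pow_add, mul_smul]; exact Submodule.smul_mem _ _ hn
    · rw [pow_add, mul_smul]; exact Submodule.smul_mem _ _ hn'
  | smul A y _ hy =>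
    obtain ⟨n, hn⟩ := hy
    obtain ⟨m, P, hP⟩ := exists_T_pow A
    refine ⟨n + m, ?_⟩
    have h := reduction_toLaurent_smul φ p (Polynomial.X ^ m) (A • y)
    rw [Polynomial.toLaurent_X_pow, smul_smul, mul_comm, ← hP, reduction_toLaurent_smul,
      Polynomial.map_pow, Polynomial.map_X] at h
    rw [pow_add, mul_smul, ← h, smul_comm]
    exact Submodule.smul_mem _ _ hn

/-- Over the domain `𝔽_p[x]` a maximal independent set of generators of `N / pN` has `r(p)`
elements, and a nonzero multiple of every element lies in its span. -/
theorem exists_maximal_independent_modP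
    (hgen : Submodule.span ℤ[T;T⁻¹] (Set.range gen) = ⊤) :
    ∃ s : Finset (Fin m), s.card = modPRank φ p ∧ ∃ B : ℤ[T;T⁻¹], ¬ C (p : ℤ) ∣ B ∧
      (∀ w, B • w ∈ Submodule.span ℤ[T;T⁻¹] (Set.range fun i : s => gen i) ⊔ multiples φ p) ∧
      ∀ c : s → ℤ[T;T⁻¹], ∑ i, c i • gen i ∈ multiples φ p → ∀ i, c i ∈ Ideal.span {C (p : ℤ)} := by
  classical
  obtain ⟨s, hs, hmax⟩ := exists_maximal_linearIndepOn (ZMod p)[X] (fun i => reduction φ p (gen i))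
  have hmul : ∀ i, ∃ P : (ZMod p)[X], P ≠ 0 ∧ P • reduction φ p (gen i) ∈
      Submodule.span (ZMod p)[X] ((fun i => reduction φ p (gen i)) '' s) := by
    intro i
    by_cases hi : i ∈ s
    · exact ⟨1, one_ne_zero, Submodule.smul_mem _ _ (Submodule.subset_span ⟨i, hi, rfl⟩)⟩
    · exact hmax i hi
  choose P hP0 hP using hmul
  -- `Q` lifts a common multiplier of all generators to `ℤ[x]`
  obtain ⟨Q, hQ⟩ := Polynomial.map_surjective _
    (ZMod.ringHom_surjective (Int.castRingHom (ZMod p))) (∏ i, P i)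
  have hdvd : ∀ Q : ℤ[X], Polynomial.C (p : ℤ) ∣ Q ↔ Q.map (Int.castRingHom (ZMod p)) = 0 := by
    intro Q
    rw [Polynomial.C_dvd_iff_dvd_coeff, Polynomial.ext_iff]
    simp [ZMod.intCast_zmod_eq_zero_iff_dvd]
  have hB : ¬ C (p : ℤ) ∣ Polynomial.toLaurent Q := by
    rw [C_dvd_toLaurent_iff, hdvd, hQ]
    exact Finset.prod_ne_zero_iff.2 fun i _ => hP0 i
  have hspan : ∀ w, Polynomial.toLaurent Q • w ∈
      Submodule.span ℤ[T;T⁻¹] (gen '' s) ⊔ multiples φ p := by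
    intro w
    have hle : Submodule.span ℤ[T;T⁻¹] (Set.range gen) ≤
        (Submodule.span ℤ[T;T⁻¹] (gen '' s) ⊔ multiples φ p).comap
          (LinearMap.lsmul _ _ (Polynomial.toLaurent Q)) := by
      rw [Submodule.span_le]
      rintro _ ⟨i, rfl⟩
      have h1 : (∏ i, P i) • reduction φ p (gen i) ∈
          Submodule.span (ZMod p)[X] ((fun i => reduction φ p (gen i)) '' s) := by
        rw [← Finset.prod_erase_mul _ _ (Finset.mem_univ i), mul_smul]
        exact Submodule.smul_mem _ _ (hP i)
      obtain ⟨u, hu, hu'⟩ := exists_reduction_eq_of_mem_span gen s h1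
      rw [← hQ, ← reduction_toLaurent_smul, ← sub_eq_zero, ← map_sub, reduction_eq_zero_iff] at hu'
      rw [SetLike.mem_coe, Submodule.mem_comap, LinearMap.lsmul_apply]
      rw [← sub_sub_cancel u (Polynomial.toLaurent Q • gen i)]
      exact Submodule.sub_mem _ (Submodule.mem_sup_left hu) (Submodule.mem_sup_right hu')
    exact hle (hgen ▸ Submodule.mem_top)
  refine ⟨s.toFinset, ?_, Polynomial.toLaurent Q, hB, ?_, ?_⟩
  -- the quotient by the span of the independent set is torsion, so both have the same rank
  · set M' := Submodule.span (ZMod p)[X] ((fun i => reduction φ p (gen i)) '' s) with hM'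
    have htors : Module.IsTorsion (ZMod p)[X]
        (Module.AEval' (generatorActionModP φ p) ⧸ M') := by
      rintro ⟨y⟩
      obtain ⟨w, rfl⟩ := reduction_surjective φ p y
      obtain ⟨u, hu, z, hz, huz⟩ := Submodule.mem_sup.1 (hspan w)
      obtain ⟨n, hn⟩ := exists_X_pow_smul_reduction_mem_span (p := p) gen s hu
      refine ⟨⟨Polynomial.X ^ n * ∏ i, P i, mem_nonZeroDivisors_of_ne_zero
        (mul_ne_zero (pow_ne_zero _ Polynomial.X_ne_zero)
          (Finset.prod_ne_zero_iff.2 fun i _ => hP0 i))⟩, ?_⟩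
      refine (Submodule.Quotient.mk_eq_zero M').2 ?_
      have hz' := (reduction_eq_zero_iff φ p).2 hz
      have := congrArg (reduction φ p) huz
      rw [map_add, hz', add_zero, reduction_toLaurent_smul, hQ] at this
      change (Polynomial.X ^ n * ∏ i, P i) • reduction φ p w ∈ M'
      rw [mul_smul, ← this]
      exact hn
    have hrank := rank_quotient_add_rank_of_isDomain (R := (ZMod p)[X]) M'
    rw [Module.rank_eq_zero_iff_isTorsion.2 htors, zero_add] at hrank
    rw [modPRank, Module.finrank, ← hrank]
    have := finrank_span_set_eq_card (R := (ZMod p)[X]) (s := (fun i => reduction φ p (gen i)) '' s)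
      hs.id_image
    rw [Module.finrank] at this
    rw [hM', this, Set.toFinset_image, Finset.card_image_of_injOn]
    simpa using hs.injOn
  · intro w
    have : (Set.range fun i : s.toFinset => gen i) = gen '' s := by
      ext y; simp
    rw [this]
    exact hspan w
  · intro c hc i
    -- multiply the relation by a power of `x` to make its coefficients polynomials
    have hex := fun i => exists_T_pow (c i)
    choose e P' hP' using hex
    set n := ∑ i, e i
    have hle : ∀ i, e i ≤ n := fun i =>
      Finset.single_le_sum (f := e) (fun _ _ => Nat.zero_le _) (Finset.mem_univ i)
    have hPX : ∀ i, Polynomial.toLaurent (P' i * Polynomial.X ^ (n - e i)) = c i * T n := by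
      intro i
      rw [map_mul, hP', Polynomial.toLaurent_X_pow, mul_assoc, ← T_add, Nat.cast_sub (hle i)]
      congr 2
      ring
    have h0 := (reduction_eq_zero_iff φ p).2 (Submodule.smul_mem _ (T n : ℤ[T;T⁻¹]) hc)
    rw [Finset.smul_sum, map_sum] at h0
    have h1 : ∑ i : s.toFinset, ((P' i * Polynomial.X ^ (n - e i)).map (Int.castRingHom (ZMod p))) •
        reduction φ p (gen i) = 0 := by
      rw [← h0]
      refine Finset.sum_congr rfl fun i _ => ?_
      rw [← reduction_toLaurent_smul, hPX, smul_smul, mul_comm]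
    have hs' : LinearIndependent (ZMod p)[X] fun i : s.toFinset => reduction φ p (gen i) :=
      hs.comp (fun i : s.toFinset => (⟨i, Set.mem_toFinset.1 i.2⟩ : s)) fun i j h =>
        Subtype.ext (congrArg (fun x : s => x.1) h)
    have h2 := Fintype.linearIndependent_iff.1 hs' _ h1 i
    rw [← hdvd, ← C_dvd_toLaurent_iff, hPX, (isUnit_T _).dvd_mul_right] at h2
    exact Ideal.mem_span_singleton.2 h2

end ReductionModP

/-! ### Clearing denominators in the rationalisation -/

section Rational

open LaurentPolynomial

/-- The inclusion `ℤ[x, x⁻¹] → ℚ[x, x⁻¹]`. -/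
noncomputable def laurentIntToRat : ℤ[T;T⁻¹] →+* ℚ[T;T⁻¹] :=
  AddMonoidAlgebra.mapRingHom ℤ (Int.castRingHom ℚ)

@[simp] theorem laurentIntToRat_coeff (A : ℤ[T;T⁻¹]) (n : ℤ) :
    (laurentIntToRat A).coeff n = A.coeff n := by
  simp [laurentIntToRat]

@[simp] theorem laurentIntToRat_C (a : ℤ) : laurentIntToRat (C a) = C (a : ℚ) := by
  ext n; simp only [laurentIntToRat_coeff, C_apply]; split_ifs <;> simp

@[simp] theorem laurentIntToRat_T (n : ℤ) : laurentIntToRat (T n) = T n := by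
  ext n; simp only [laurentIntToRat_coeff, T_apply]; split_ifs <;> simp

theorem laurentIntToRat_injective : Function.Injective laurentIntToRat := by
  intro A B h
  ext n
  have := congrArg (fun q => q.coeff n) h
  simpa using this

theorem C_intCast_ne_zero {c : ℤ} (hc : c ≠ 0) : (C (c : ℚ) : ℚ[T;T⁻¹]) ≠ 0 := by
  rw [← laurentIntToRat_C, map_ne_zero_iff _ laurentIntToRat_injective, ← Polynomial.toLaurent_C]
  exact Polynomial.toLaurent_ne_zero.2 (Polynomial.C_ne_zero.2 hc)

theorem exists_C_mul_eq_laurentIntToRat (q : ℚ[T;T⁻¹]) :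
    ∃ c : ℤ, c ≠ 0 ∧ ∃ A : ℤ[T;T⁻¹], C (c : ℚ) * q = laurentIntToRat A := by
  induction q using LaurentPolynomial.induction_on' with
  | add p q hp hq =>
    obtain ⟨c, hc, A, hA⟩ := hp
    obtain ⟨c', hc', A', hA'⟩ := hq
    refine ⟨c * c', mul_ne_zero hc hc', C c' * A + C c * A', ?_⟩
    rw [map_add, map_mul, map_mul, ← hA, ← hA', laurentIntToRat_C, laurentIntToRat_C, Int.cast_mul,
      map_mul]
    ring
  | C_mul_T n a =>
    refine ⟨a.den, by exact_mod_cast a.den_ne_zero, C a.num * T n, ?_⟩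
    rw [map_mul, laurentIntToRat_C, laurentIntToRat_T, ← mul_assoc, ← map_mul]
    congr 2
    rw [mul_comm]
    exact_mod_cast Rat.mul_den_eq_num a

/-- A common denominator for a finite family. -/
theorem exists_C_mul_eq_laurentIntToRat_forall {ι : Type*} [Fintype ι] (q : ι → ℚ[T;T⁻¹]) :
    ∃ c : ℤ, c ≠ 0 ∧ ∃ A : ι → ℤ[T;T⁻¹], ∀ i, C (c : ℚ) * q i = laurentIntToRat (A i) := by
  classical
  choose c hc A hA using fun i => exists_C_mul_eq_laurentIntToRat (q i)
  refine ⟨∏ i, c i, Finset.prod_ne_zero_iff.2 fun i _ => hc i,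
    fun i => C (∏ j ∈ Finset.univ.erase i, c j) * A i, fun i => ?_⟩
  rw [map_mul, ← hA, laurentIntToRat_C, ← mul_assoc, ← map_mul, ← Int.cast_mul,
    Finset.prod_erase_mul _ _ (Finset.mem_univ i)]

theorem exists_int_smul_mem_of_finite {V : Type*} [AddCommGroup V] [Module ℤ[T;T⁻¹] V]
    [Module.Finite ℤ[T;T⁻¹] V] (P : Submodule ℤ[T;T⁻¹] V)
    (h : ∀ w, ∃ c : ℤ, c ≠ 0 ∧ (C c : ℤ[T;T⁻¹]) • w ∈ P) :
    ∃ c : ℤ, c ≠ 0 ∧ ∀ w, (C c : ℤ[T;T⁻¹]) • w ∈ P := by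
  classical
  obtain ⟨n, v, hv⟩ := Module.Finite.exists_fin (R := ℤ[T;T⁻¹]) (M := V)
  choose c hc hcP using fun i => h (v i)
  refine ⟨∏ i, c i, Finset.prod_ne_zero_iff.2 fun i _ => hc i, fun w => ?_⟩
  have hle : Submodule.span ℤ[T;T⁻¹] (Set.range v) ≤
      P.comap (LinearMap.lsmul _ _ (C (∏ i, c i) : ℤ[T;T⁻¹])) := by
    rw [Submodule.span_le]
    rintro _ ⟨i, rfl⟩
    rw [SetLike.mem_coe, Submodule.mem_comap, LinearMap.lsmul_apply,
      ← Finset.prod_erase_mul _ _ (Finset.mem_univ i), map_mul, mul_smul]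
    exact P.smul_mem _ (hcP i)
  exact hle (hv ▸ Submodule.mem_top)

variable {N : Type*} [CommGroup N] (φ : Multiplicative ℤ →* MulAut N)

/-- The natural map `N → ℚ ⊗ N`. -/
noncomputable def rationalization : IntegralModule φ →+ RationalModule φ :=
  ((TensorProduct.mk ℤ ℚ (Additive N) 1).toAddMonoidHom).comp
    (toIntegralModule φ).symm.toAddMonoidHom

theorem rationalization_smul (A : ℤ[T;T⁻¹]) (v : IntegralModule φ) :
    rationalization φ (A • v) = laurentIntToRat A • rationalization φ v := by
  have hC : ∀ (a : ℤ) v, rationalization φ ((C a : ℤ[T;T⁻¹]) • v) =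
      (C (a : ℚ) : ℚ[T;T⁻¹]) • rationalization φ v := by
    intro a v
    rw [C_smul_integralModule, map_zsmul]
    refine Eq.trans ?_ (LaurentModule.C_smul
      ((generatorAction φ).baseChange ℤ ℚ (Additive N) (Additive N)) (a : ℚ)
      ((1 : ℚ) ⊗ₜ[ℤ] (toIntegralModule φ).symm v)).symm
    exact (Int.cast_smul_eq_zsmul ℚ a ((1 : ℚ) ⊗ₜ[ℤ] (toIntegralModule φ).symm v)).symm
  have hT : ∀ v, rationalization φ ((T 1 : ℤ[T;T⁻¹]) • v) =
      (T 1 : ℚ[T;T⁻¹]) • rationalization φ v := by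
    intro v
    have h : (T 1 : ℤ[T;T⁻¹]) • v =
        toIntegralModule φ (generatorAction φ ((toIntegralModule φ).symm v)) :=
      LaurentModule.T_one_smul (generatorAction φ) v
    rw [h]
    refine Eq.trans ?_ (LaurentModule.T_one_smul
      ((generatorAction φ).baseChange ℤ ℚ (Additive N) (Additive N))
      ((1 : ℚ) ⊗ₜ[ℤ] (toIntegralModule φ).symm v)).symm
    rfl
  have hT' : ∀ v, rationalization φ ((T (-1) : ℤ[T;T⁻¹]) • v) =
      (T (-1) : ℚ[T;T⁻¹]) • rationalization φ v := by
    intro v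
    have h := hT ((T (-1) : ℤ[T;T⁻¹]) • v)
    rw [smul_smul, ← T_add, show (1 : ℤ) + -1 = 0 by norm_num, T_zero, one_smul] at h
    rw [h, smul_smul, ← T_add, show (-1 : ℤ) + 1 = 0 by norm_num, T_zero, one_smul]
  induction A using LaurentPolynomial.induction_on generalizing v with
  | h_C a => rw [hC, laurentIntToRat_C]
  | h_add hp hq => rw [add_smul, map_add, hp, hq, map_add, add_smul]
  | h_C_mul_T n a h =>
    rw [T_add, ← mul_assoc, mul_smul, h, hT, map_mul _ _ (T 1), laurentIntToRat_T, mul_smul]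
  | h_C_mul_T_Z n a h =>
    rw [sub_eq_add_neg, T_add, ← mul_assoc, mul_smul, h, hT', map_mul _ _ (T (-1)),
      laurentIntToRat_T, mul_smul]

theorem exists_smul_eq_rationalization (y : RationalModule φ) :
    ∃ b : ℤ, b ≠ 0 ∧ ∃ v, (C (b : ℚ) : ℚ[T;T⁻¹]) • y = rationalization φ v := by
  let y' : ℚ ⊗[ℤ] Additive N := y
  obtain ⟨⟨v, b⟩, h⟩ := IsLocalizedModule.surj (nonZeroDivisors ℤ)
    (TensorProduct.mk ℤ ℚ (Additive N) 1) y'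
  refine ⟨b, nonZeroDivisors.ne_zero b.2, toIntegralModule φ v, ?_⟩
  refine (LaurentModule.C_smul
    ((generatorAction φ).baseChange ℤ ℚ (Additive N) (Additive N)) ((b : ℤ) : ℚ) y').trans
      (Eq.trans ?_ h)
  exact Int.cast_smul_eq_zsmul ℚ (b : ℤ) y'

theorem exists_smul_eq_zero_of_rationalization_eq_zero {v : IntegralModule φ}
    (hv : rationalization φ v = 0) : ∃ c : ℤ, c ≠ 0 ∧ (C c : ℤ[T;T⁻¹]) • v = 0 := by
  obtain ⟨c, hc⟩ := (IsLocalizedModule.eq_zero_iff (nonZeroDivisors ℤ)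
    (TensorProduct.mk ℤ ℚ (Additive N) 1)).1 hv
  exact ⟨c, nonZeroDivisors.ne_zero c.2, (C_smul_integralModule φ c v).trans hc⟩

/-- The decomposition of `ℚ ⊗ N`, after clearing denominators: elements `v` of `N` whose span
contains a multiple of `N` and whose relations are, up to scalars, those of the decomposition. -/
theorem exists_integral_generators [Module.Finite ℤ[T;T⁻¹] (IntegralModule φ)] {s₀ r₀ : ℕ}
    {a : Fin s₀ → ℚ[T;T⁻¹]} (ha : ∀ j, a j ≠ 0)
    (e : RationalModule φ ≃ₗ[ℚ[T;T⁻¹]]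
      ((j : Fin s₀) → ℚ[T;T⁻¹] ⧸ Ideal.span {a j}) × (Fin r₀ → ℚ[T;T⁻¹])) :
    ∃ (v : Fin s₀ ⊕ Fin r₀ → IntegralModule φ) (c : ℤ) (A : ℤ[T;T⁻¹]), c ≠ 0 ∧ A ≠ 0 ∧
      (∀ w, (C c : ℤ[T;T⁻¹]) • w ∈ Submodule.span ℤ[T;T⁻¹] (Set.range v)) ∧
      (∀ j, A • v (Sum.inl j) = 0) ∧
      ∀ f : Fin s₀ ⊕ Fin r₀ → ℤ[T;T⁻¹], ∑ i, f i • v i = 0 →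
        (∀ j, laurentIntToRat (f (Sum.inl j)) ∈ Ideal.span {a j}) ∧ ∀ i, f (Sum.inr i) = 0 := by
  classical
  let bas : Fin s₀ ⊕ Fin r₀ →
      ((j : Fin s₀) → ℚ[T;T⁻¹] ⧸ Ideal.span {a j}) × (Fin r₀ → ℚ[T;T⁻¹]) :=
    Sum.elim (fun j => (Pi.single j 1, 0)) (fun i => (0, Pi.single i 1))
  choose b hb v hv using fun i => exists_smul_eq_rationalization φ (e.symm (bas i))
  have hev : ∀ i, e (rationalization φ (v i)) = (C (b i : ℚ) : ℚ[T;T⁻¹]) • bas i := fun i => by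
    rw [← hv, map_smul, e.apply_symm_apply]
  have hunit : ∀ c : ℤ, c ≠ 0 → (C ((c : ℚ)⁻¹) * C (c : ℚ) : ℚ[T;T⁻¹]) = 1 := fun c hc => by
    rw [← map_mul, inv_mul_cancel₀ (Int.cast_ne_zero.2 hc), map_one]
  have hone : ∀ (I : Ideal ℚ[T;T⁻¹]) (q : ℚ[T;T⁻¹]),
      q • (1 : ℚ[T;T⁻¹] ⧸ I) = Ideal.Quotient.mk I q := fun I q =>
    congrArg (Ideal.Quotient.mk I) (mul_one q)
  have hspan : ∀ w, ∃ c : ℤ, c ≠ 0 ∧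
      (C c : ℤ[T;T⁻¹]) • w ∈ Submodule.span ℤ[T;T⁻¹] (Set.range v) := by
    intro w
    obtain ⟨q, hq⟩ : ∃ q : Fin s₀ ⊕ Fin r₀ → ℚ[T;T⁻¹],
        e (rationalization φ w) = ∑ i, q i • e (rationalization φ (v i)) := by
      choose x hx using fun j => Ideal.Quotient.mk_surjective ((e (rationalization φ w)).1 j)
      refine ⟨fun i => Sum.elim x (e (rationalization φ w)).2 i * C (((b i : ℤ) : ℚ)⁻¹), ?_⟩
      simp_rw [hev, smul_smul, mul_assoc, hunit _ (hb _), mul_one]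
      rw [Fintype.sum_sum_type]
      ext1
      · rw [Prod.fst_add, Prod.fst_sum, Prod.fst_sum]
        ext1 j
        simp only [Sum.elim_inl, Sum.elim_inr, bas, Prod.smul_mk, smul_zero, Finset.sum_const_zero,
          add_zero, Finset.sum_apply, Pi.smul_apply]
        rw [Finset.sum_eq_single j]
        · rw [Pi.single_eq_same, ← hx, hone]
        · intro k _ hk
          rw [Pi.single_eq_of_ne hk.symm, smul_zero]
        · simp
      · rw [Prod.snd_add, Prod.snd_sum, Prod.snd_sum]
        ext1 j
        simp only [Sum.elim_inl, Sum.elim_inr, bas, Prod.smul_mk, smul_zero, Finset.sum_const_zero,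
          zero_add, Finset.sum_apply, Pi.smul_apply]
        simp [Pi.single_apply]
    obtain ⟨c, hc, A, hA⟩ := exists_C_mul_eq_laurentIntToRat_forall q
    have h0 : rationalization φ ((C c : ℤ[T;T⁻¹]) • w - ∑ i, A i • v i) = 0 := by
      apply e.injective
      rw [map_zero, map_sub, rationalization_smul, map_sum, map_sub, map_sum, map_smul, hq,
        laurentIntToRat_C, Finset.smul_sum, sub_eq_zero]
      refine Finset.sum_congr rfl fun i _ => ?_
      rw [rationalization_smul, map_smul, ← hA, mul_smul]
    obtain ⟨c', hc', h'⟩ := exists_smul_eq_zero_of_rationalization_eq_zero φ h0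
    refine ⟨c' * c, mul_ne_zero hc' hc, ?_⟩
    rw [smul_sub, sub_eq_zero] at h'
    rw [map_mul, mul_smul, h']
    exact Submodule.smul_mem _ _ (Submodule.sum_mem _ fun i _ =>
      Submodule.smul_mem _ _ (Submodule.subset_span ⟨i, rfl⟩))
  obtain ⟨c, hc, hcw⟩ := exists_int_smul_mem_of_finite _ hspan
  have hA : ∀ j, ∃ A : ℤ[T;T⁻¹], A ≠ 0 ∧ A • v (Sum.inl j) = 0 := by
    intro j
    obtain ⟨c, hc, A, hA⟩ := exists_C_mul_eq_laurentIntToRat (a j)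
    have hA0 : A ≠ 0 := by
      rintro rfl
      rw [map_zero] at hA
      exact (mul_ne_zero (C_intCast_ne_zero hc) (ha j)) hA
    have h0 : rationalization φ (A • v (Sum.inl j)) = 0 := by
      apply e.injective
      rw [map_zero, rationalization_smul, map_smul, hev, ← hA, smul_smul]
      ext1
      · ext1 k
        simp only [bas, Sum.elim_inl, Prod.smul_mk, Pi.smul_apply, Prod.fst_zero, Pi.zero_apply]
        by_cases hk : k = j
        · subst hk
          rw [Pi.single_eq_same, hone]
          refine Ideal.Quotient.eq_zero_iff_mem.2 (Ideal.mem_span_singleton.2 ?_)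
          exact dvd_mul_of_dvd_left (dvd_mul_left _ _) _
        · rw [Pi.single_eq_of_ne hk, smul_zero]
      · simp [bas]
    obtain ⟨c', hc', h'⟩ := exists_smul_eq_zero_of_rationalization_eq_zero φ h0
    refine ⟨C c' * A, mul_ne_zero ?_ hA0, by rw [mul_smul, h']⟩
    rw [← Polynomial.toLaurent_C]
    exact Polynomial.toLaurent_ne_zero.2 (Polynomial.C_ne_zero.2 hc')
  choose A hA0 hAv using hA
  refine ⟨v, c, ∏ j, A j, hc, Finset.prod_ne_zero_iff.2 fun j _ => hA0 j, hcw, fun j => ?_, ?_⟩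
  · rw [← Finset.prod_erase_mul _ _ (Finset.mem_univ j), mul_smul, hAv, smul_zero]
  · intro f hf
    have h0 : ∑ i, (laurentIntToRat (f i) * C (b i : ℚ)) • bas i = 0 := by
      rw [← map_zero e, ← map_zero (rationalization φ), ← hf, map_sum, map_sum]
      refine Finset.sum_congr rfl fun i _ => ?_
      rw [rationalization_smul, map_smul, hev, mul_smul]
    rw [Fintype.sum_sum_type] at h0
    constructor
    · intro j
      have h1 := congrFun (congrArg Prod.fst h0) j
      rw [Prod.fst_add, Prod.fst_sum, Prod.fst_sum] at h1
      simp only [Sum.elim_inl, Sum.elim_inr, bas, Prod.smul_mk, smul_zero, Finset.sum_const_zero,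
          add_zero, Finset.sum_apply, Pi.smul_apply, Prod.fst_zero, Pi.zero_apply] at h1
      rw [Finset.sum_eq_single j (fun k _ hk => by rw [Pi.single_eq_of_ne hk.symm, smul_zero])
        (by simp), Pi.single_eq_same, hone] at h1
      have h2 := Ideal.mul_mem_left _ (C (((b (Sum.inl j) : ℤ) : ℚ)⁻¹))
        (Ideal.Quotient.eq_zero_iff_mem.1 h1)
      rwa [mul_left_comm, hunit _ (hb _), mul_one] at h2
    · intro i
      have h1 := congrFun (congrArg Prod.snd h0) i
      rw [Prod.snd_add, Prod.snd_sum, Prod.snd_sum] at h1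
      simp [bas, Pi.single_apply] at h1
      have h2 := h1.resolve_right fun h => C_intCast_ne_zero (hb (Sum.inr i)) (by simpa using h)
      exact (map_eq_zero_iff _ laurentIntToRat_injective).1 h2

end Rational

/-! ### Primes modulo which a polynomial has a root -/

section Roots

open LaurentPolynomial

/-- A nonconstant integral polynomial with nonzero constant term has a nonzero root modulo
infinitely many primes. -/
theorem infinite_setOf_prime_root {f : ℤ[X]} (hf : 0 < f.natDegree) (h0 : f.coeff 0 ≠ 0) :
    {p : ℕ | p.Prime ∧ ∃ z : ℤ, (p : ℤ) ∣ f.eval z ∧ ¬ (p : ℤ) ∣ z}.Infinite := by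
  rw [Set.infinite_iff_exists_gt]
  intro M₀
  set c := f.coeff 0 with hc
  set M := max M₀ c.natAbs
  have hM : (c * (M.factorial : ℤ)) ≠ 0 := mul_ne_zero h0 (by exact_mod_cast M.factorial_ne_zero)
  have hg : f ^ 2 - Polynomial.C (c ^ 2) ≠ 0 := by
    intro h
    have h1 := congrArg Polynomial.natDegree (sub_eq_zero.1 h)
    rw [Polynomial.natDegree_pow, Polynomial.natDegree_C] at h1
    omega
  obtain ⟨t, ht⟩ : ∃ t : ℤ,
      (f ^ 2 - Polynomial.C (c ^ 2)).eval (c * (M.factorial : ℤ) * t) ≠ 0 := by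
    by_contra! h
    refine hg (Polynomial.eq_zero_of_infinite_isRoot _ ?_)
    refine (Set.infinite_range_of_injective (mul_right_injective₀ hM)).mono ?_
    rintro _ ⟨t, rfl⟩
    exact h t
  -- `f z = c * (1 + M! * t * q)`, and no prime up to `M` divides the second factor
  set z := c * (M.factorial : ℤ) * t with hz
  set q := f.divX.eval z
  have hfz : f.eval z = c * (1 + (M.factorial : ℤ) * t * q) := by
    conv_lhs => rw [← Polynomial.divX_mul_X_add f]
    rw [Polynomial.eval_add, Polynomial.eval_mul, Polynomial.eval_X, Polynomial.eval_C, ← hc]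
    change q * z + c = _
    rw [hz]; ring
  have hne : (1 + (M.factorial : ℤ) * t * q).natAbs ≠ 1 := by
    intro h
    apply ht
    rw [Polynomial.eval_sub, Polynomial.eval_pow, Polynomial.eval_C, hfz]
    have : (1 + (M.factorial : ℤ) * t * q) ^ 2 = 1 := by rw [← Int.natAbs_sq, h]; norm_num
    rw [mul_pow, this, mul_one, sub_self]
  obtain ⟨p, hp, hpd⟩ := Nat.exists_prime_and_dvd hne
  have hpd' : (p : ℤ) ∣ 1 + (M.factorial : ℤ) * t * q := Int.natCast_dvd.2 hpd
  have hpp := Nat.prime_iff_prime_int.1 hp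
  have hnot : ¬ (p : ℤ) ∣ (M.factorial : ℤ) * t := fun h =>
    hpp.not_dvd_one ((Int.dvd_add_left (h.mul_right q)).1 hpd')
  have hpM : M < p := by
    by_contra! h
    exact hnot ((Int.natCast_dvd_natCast.2 (hp.dvd_factorial.2 h)).mul_right t)
  have hpc : ¬ (p : ℤ) ∣ c := fun h => by
    have := Nat.le_of_dvd (Int.natAbs_pos.2 h0) (Int.natCast_dvd.1 h)
    have := le_max_right M₀ c.natAbs
    omega
  refine ⟨p, ⟨hp, z, ?_, ?_⟩, (le_max_left _ _).trans_lt hpM⟩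
  · rw [hfz]; exact hpd'.mul_left c
  · rw [hz, mul_assoc]
    exact fun h => (hpp.dvd_or_dvd h).elim hpc hnot

theorem laurentIntToRat_toLaurent (P : ℤ[X]) :
    laurentIntToRat (Polynomial.toLaurent P) =
      Polynomial.toLaurent (P.map (Int.castRingHom ℚ)) := by
  have : laurentIntToRat.comp (Polynomial.toLaurent : ℤ[X] →+* ℤ[T;T⁻¹]) =
      (Polynomial.toLaurent : ℚ[X] →+* ℚ[T;T⁻¹]).comp (Polynomial.mapRingHom (Int.castRingHom ℚ)) :=
    Polynomial.ringHom_ext (by simp) (by simp)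
  exact RingHom.congr_fun this P

/-- Every proper nonzero ideal of `ℚ[x, x⁻¹]` is governed by a primitive integral polynomial with
nonzero constant term. -/
theorem exists_primitive_polynomial {a : ℚ[T;T⁻¹]} (ha : a ≠ 0) (hau : ¬ IsUnit a) :
    ∃ f : ℤ[X], 0 < f.natDegree ∧ f.coeff 0 ≠ 0 ∧ ∀ (A : ℤ[T;T⁻¹]),
      laurentIntToRat A ∈ Ideal.span {a} →
        ∃ (n e : ℕ) (P : ℤ[X]), Polynomial.toLaurent P = A * T n ∧ f ∣ P * Polynomial.X ^ e := by
  obtain ⟨m, g, hg⟩ := exists_T_pow a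
  have hg0 : g ≠ 0 := by
    rintro rfl
    rw [map_zero] at hg
    exact ha ((isUnit_T (m : ℤ)).mul_left_eq_zero.1 hg.symm)
  obtain ⟨h, hgh, hX⟩ := Polynomial.exists_eq_pow_rootMultiplicity_mul_and_not_dvd g hg0 0
  rw [map_zero, sub_zero] at hgh hX
  set k := g.rootMultiplicity 0
  have hh0 : h ≠ 0 := by rintro rfl; exact hX (dvd_zero _)
  set f₀ := IsLocalization.integerNormalization (nonZeroDivisors ℤ) h
  obtain ⟨b, hbm, hb⟩ := IsLocalization.integerNormalization_spec (nonZeroDivisors ℤ) h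
  have hf₀ : f₀ ≠ 0 := (IsFractionRing.integerNormalization_eq_zero_iff).not.2 hh0
  set f := f₀.primPart
  have hcontent : f₀.content ≠ 0 := Polynomial.content_eq_zero_iff.not.2 hf₀
  -- `f` and `h` differ by a nonzero rational constant
  have hassoc : Associated (f.map (Int.castRingHom ℚ)) h := by
    have h1 : f₀.map (Int.castRingHom ℚ) =
        Polynomial.C (f₀.content : ℚ) * f.map (Int.castRingHom ℚ) := by
      conv_lhs => rw [f₀.eq_C_content_mul_primPart]
      simp [f]
    have h2 : f₀.map (Int.castRingHom ℚ) = Polynomial.C (b : ℚ) * h := by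
      refine hb.trans ?_
      rw [← Polynomial.smul_eq_C_mul, Int.cast_smul_eq_zsmul]
    have hu : ∀ z : ℤ, z ≠ 0 → IsUnit (Polynomial.C (z : ℚ)) := fun z hz =>
      Polynomial.isUnit_C.2 (isUnit_iff_ne_zero.2 (Int.cast_ne_zero.2 hz))
    have h3 := (associated_isUnit_mul_left_iff (b := h)
      (hu _ (nonZeroDivisors.ne_zero hbm))).2 (Associated.refl h)
    have h4 := (associated_isUnit_mul_left_iff (b := f.map (Int.castRingHom ℚ))
      (hu _ hcontent)).2 (Associated.refl _)
    rw [← h2, h1] at h3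
    exact h4.symm.trans h3
  have hprim : f.IsPrimitive := f₀.isPrimitive_primPart
  have hfm : f.map (Int.castRingHom ℚ) ∣ h := hassoc.dvd
  refine ⟨f, ?_, ?_, ?_⟩
  · by_contra! hdeg
    have h1 : f.map (Int.castRingHom ℚ) = Polynomial.C ((f.coeff 0 : ℤ) : ℚ) := by
      rw [Polynomial.eq_C_of_natDegree_le_zero hdeg]; simp
    have h2 : IsUnit (f.map (Int.castRingHom ℚ)) := by
      rw [h1, Polynomial.isUnit_C, isUnit_iff_ne_zero]
      intro h0
      rw [h0, map_zero] at h1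
      rw [h1] at hassoc
      exact hh0 ((associated_zero_iff_eq_zero h).1 hassoc.symm)
    have h3 : IsUnit (a * T m) := by
      rw [← hg, hgh, map_mul, Polynomial.toLaurent_X_pow]
      exact (isUnit_T _).mul ((hassoc.isUnit h2).map _)
    exact hau (isUnit_of_mul_isUnit_left h3)
  · intro h0
    refine hX ((Polynomial.X_dvd_iff.2 ?_ : Polynomial.X ∣ f.map (Int.castRingHom ℚ)).trans hfm)
    rw [Polynomial.coeff_map, h0, map_zero]
  · intro A hA
    obtain ⟨q, hq⟩ := Ideal.mem_span_singleton.1 hA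
    obtain ⟨n, P, hP⟩ := exists_T_pow A
    obtain ⟨n', q', hq'⟩ := exists_T_pow q
    refine ⟨n, m + n', P, hP, ?_⟩
    have h1 : P.map (Int.castRingHom ℚ) * Polynomial.X ^ (m + n') = g * q' * Polynomial.X ^ n := by
      apply Polynomial.toLaurent_injective
      rw [map_mul, map_mul, map_mul, ← laurentIntToRat_toLaurent, hP, hg, hq', map_mul, hq,
        Polynomial.toLaurent_X_pow, Polynomial.toLaurent_X_pow, laurentIntToRat_T, Nat.cast_add,
        T_add]
      ring
    have h2 : f.map (Int.castRingHom ℚ) ∣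
        (P * Polynomial.X ^ (m + n')).map (Int.castRingHom ℚ) := by
      rw [Polynomial.map_mul, Polynomial.map_pow, Polynomial.map_X, h1, hgh, mul_assoc, mul_assoc]
      exact (hfm.mul_right _).mul_left _
    exact (Polynomial.IsPrimitive.Int.dvd_iff_map_cast_dvd_map_cast f _ hprim).2 h2

/-- Infinitely many prime fields are quotients of `ℤ[x, x⁻¹]` in which a proper nonzero ideal of
`ℚ[x, x⁻¹]` vanishes. -/
theorem infinite_setOf_prime_hom {a : ℚ[T;T⁻¹]} (ha : a ≠ 0) (hau : ¬ IsUnit a) :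
    {p : ℕ | p.Prime ∧ ∃ l : ℤ[T;T⁻¹] →+* ZMod p,
      ∀ A, laurentIntToRat A ∈ Ideal.span {a} → l A = 0}.Infinite := by
  obtain ⟨f, hdeg, hf0, hf⟩ := exists_primitive_polynomial ha hau
  refine (infinite_setOf_prime_root hdeg hf0).mono ?_
  rintro p ⟨hp, z, hz, hpz⟩
  have : Fact p.Prime := ⟨hp⟩
  have hz0 : (z : ZMod p) ≠ 0 := fun h => hpz ((ZMod.intCast_zmod_eq_zero_iff_dvd z p).1 h)
  set l := (laurentHomEquiv (ZMod p)).symm (Units.mk0 _ hz0)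
  have hl : l (T 1) = z :=
    congrArg Units.val ((laurentHomEquiv (ZMod p)).apply_symm_apply (Units.mk0 _ hz0))
  refine ⟨hp, l, fun A hA => ?_⟩
  obtain ⟨n, e, P, hP, hdvd⟩ := hf A hA
  have h1 : f.eval₂ (Int.castRingHom (ZMod p)) (z : ZMod p) = 0 := by
    rw [show (z : ZMod p) = Int.castRingHom (ZMod p) z from rfl, Polynomial.eval₂_hom]
    exact (ZMod.intCast_zmod_eq_zero_iff_dvd _ p).2 hz
  have h2 := Polynomial.eval₂_eq_zero_of_dvd_of_eval₂_eq_zero (Int.castRingHom (ZMod p))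
    (z : ZMod p) hdvd h1
  rw [Polynomial.eval₂_mul, Polynomial.eval₂_X_pow, ← hl, ← map_toLaurent, hP, map_mul] at h2
  have h3 := (mul_eq_zero.1 h2).resolve_right (pow_ne_zero _ (T_one_map_ne_zero l))
  exact (mul_eq_zero.1 h3).resolve_right ((isUnit_T _).map l).ne_zero

end Roots

/-! ### Finite modules -/

section FiniteModules

open LaurentPolynomial

theorem finite_laurent_quotient {p : ℕ} (hp : p.Prime) {B : ℤ[T;T⁻¹]} (hB : ¬ C (p : ℤ) ∣ B) :
    Finite (ℤ[T;T⁻¹] ⧸ Ideal.span {C (p : ℤ), B}) := by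
  have : Fact p.Prime := ⟨hp⟩
  set J := Ideal.span {C (p : ℤ), B}
  obtain ⟨m, P, hP⟩ := exists_T_pow B
  set Q := P.map (Int.castRingHom (ZMod p))
  have hQ : Q ≠ 0 := by
    intro h
    refine hB ((C_dvd_iff_of_eq_mul_T hP).2 (Polynomial.C_dvd_iff_dvd_coeff _ _ |>.2 fun i => ?_))
    rw [← ZMod.intCast_zmod_eq_zero_iff_dvd]
    simpa [Q] using congrArg (fun Q => Q.coeff i) h
  have hpJ : ((p : ℕ) : ℤ[T;T⁻¹] ⧸ J) = 0 := by
    have h : Ideal.Quotient.mk J (C (p : ℤ)) = 0 :=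
      Ideal.Quotient.eq_zero_iff_mem.2 (Ideal.subset_span (Set.mem_insert _ _))
    simpa using h
  rcases subsingleton_or_nontrivial (ℤ[T;T⁻¹] ⧸ J) with hs | hs
  · infer_instance
  have : CharP (ℤ[T;T⁻¹] ⧸ J) p := (CharP.charP_iff_prime_eq_zero hp).2 hpJ
  let i : ZMod p →+* ℤ[T;T⁻¹] ⧸ J := ZMod.castHom dvd_rfl _
  have hroot : Q.eval₂ i (Ideal.Quotient.mk J (T 1)) = 0 := by
    have h1 : ((Ideal.Quotient.mk J).comp (Polynomial.toLaurent : ℤ[X] →+* ℤ[T;T⁻¹])) =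
        Polynomial.eval₂RingHom (i.comp (Int.castRingHom (ZMod p)))
          (Ideal.Quotient.mk J (T 1)) :=
      Polynomial.ringHom_ext (by simp) (by simp)
    rw [Polynomial.eval₂_map]
    refine (RingHom.congr_fun h1 P).symm.trans ?_
    rw [RingHom.comp_apply, hP, map_mul, Ideal.Quotient.eq_zero_iff_mem.2
      (show B ∈ J from Ideal.subset_span (Set.mem_insert_of_mem _ rfl)), zero_mul]
  let f : AdjoinRoot Q →+* ℤ[T;T⁻¹] ⧸ J := AdjoinRoot.lift i _ hroot
  have hfin : Finite (AdjoinRoot Q) := by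
    have := (AdjoinRoot.powerBasis hQ).finite
    exact Module.finite_of_finite (ZMod p)
  have hfr : Finite f.range := Set.finite_range f
  have hT : Ideal.Quotient.mk J (T 1) ∈ f.range := ⟨AdjoinRoot.root Q, AdjoinRoot.lift_root hroot⟩
  have hTu : Ideal.Quotient.mk J (T (-1)) * Ideal.Quotient.mk J (T 1) = 1 := by
    rw [← map_mul, ← T_add, neg_add_cancel, T_zero, map_one]
  -- a finite subring contains the inverse of each of its elements that is a unit
  have hT' : Ideal.Quotient.mk J (T (-1)) ∈ f.range := by
    have hinj : Function.Injective fun y : f.range => (⟨_, hT⟩ : f.range) * y := by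
      intro y z hyz
      have h := congrArg (fun w : f.range => Ideal.Quotient.mk J (T (-1)) * w.1) hyz
      simp only [Subring.coe_mul, ← mul_assoc, hTu, one_mul] at h
      exact Subtype.ext h
    obtain ⟨y, hy⟩ := Finite.surjective_of_injective hinj 1
    have h := congrArg (fun w : f.range => Ideal.Quotient.mk J (T (-1)) * w.1) hy
    simp only [Subring.coe_mul, ← mul_assoc, hTu, one_mul, Subring.coe_one, mul_one] at h
    rw [← h]
    exact y.2
  have hmem : ∀ A, Ideal.Quotient.mk J A ∈ f.range := by
    intro A
    induction A using LaurentPolynomial.induction_on with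
    | h_C a =>
      have : Ideal.Quotient.mk J (C a) = (a : ℤ[T;T⁻¹] ⧸ J) := by simp
      rw [this]
      exact intCast_mem _ a
    | h_add hp hq => rw [map_add]; exact add_mem hp hq
    | h_C_mul_T n a h => rw [T_add, ← mul_assoc, map_mul]; exact mul_mem h hT
    | h_C_mul_T_Z n a h =>
      rw [sub_eq_add_neg, T_add, ← mul_assoc, map_mul]; exact mul_mem h hT'
  refine Finite.of_surjective f fun y => ?_
  obtain ⟨A, rfl⟩ := Ideal.Quotient.mk_surjective y
  exact hmem A

theorem finite_quotient_of_forall_smul_mem {R V : Type*} [CommRing R] [AddCommGroup V] [Module R V]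
    [Module.Finite R V] (J : Ideal R) [Finite (R ⧸ J)] (K : Submodule R V)
    (h : ∀ a ∈ J, ∀ w, a • w ∈ K) : Finite (V ⧸ K) := by
  obtain ⟨n, v, hv⟩ := Module.Finite.exists_fin (R := R) (M := V)
  refine Finite.of_surjective
    (fun c : Fin n → R ⧸ J => K.mkQ (∑ i, (c i).out • v i)) fun y => ?_
  obtain ⟨w, rfl⟩ := K.mkQ_surjective y
  obtain ⟨c, rfl⟩ := (Submodule.mem_span_range_iff_exists_fun R).1
    (hv ▸ Submodule.mem_top : w ∈ Submodule.span R (Set.range v))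
  refine ⟨fun i => Ideal.Quotient.mk J (c i), ?_⟩
  rw [← sub_eq_zero, ← map_sub, ← Finset.sum_sub_distrib, Submodule.mkQ_apply,
    Submodule.Quotient.mk_eq_zero]
  refine Submodule.sum_mem _ fun i _ => ?_
  rw [← sub_smul]
  exact h _ (Ideal.Quotient.eq.1 (Quotient.out_eq _)) _

/-- If `A / pA` is finite for every prime `p` then `A / nA` is finite for every `n ≠ 0`. -/
theorem index_nsmul_range_ne_zero {A : Type*} [AddCommGroup A]
    (h : ∀ p : ℕ, p.Prime → (nsmulAddMonoidHom (α := A) p).range.index ≠ 0) {n : ℕ} (hn : n ≠ 0) :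
    (nsmulAddMonoidHom (α := A) n).range.index ≠ 0 := by
  induction n using Nat.recOnMul with
  | zero => exact absurd rfl hn
  | one =>
    have : (nsmulAddMonoidHom (α := A) 1).range = ⊤ :=
      AddMonoidHom.range_eq_top.2 fun a => ⟨a, one_nsmul a⟩
    rw [this, AddSubgroup.index_top]
    exact one_ne_zero
  | prime p hp => exact h p hp
  | mul a b ha hb =>
    have hr : (nsmulAddMonoidHom (α := A) (a * b)).range =
        (nsmulAddMonoidHom (α := A) a).range.map (nsmulAddMonoidHom (α := A) b) := by
      rw [← AddMonoidHom.range_comp]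
      congr 1
      ext x
      exact mul_nsmul x a b
    rw [hr, AddSubgroup.index_map]
    refine mul_ne_zero (fun h0 => ha (left_ne_zero_of_mul hn) ?_) (hb (right_ne_zero_of_mul hn))
    exact Nat.eq_zero_of_zero_dvd (h0 ▸ AddSubgroup.index_dvd_of_le le_sup_left)

variable {N : Type*} [CommGroup N] {φ : Multiplicative ℤ →* MulAut N}

theorem finite_of_modPRank_eq_zero [Module.Finite ℤ[T;T⁻¹] (IntegralModule φ)]
    (hr : ∀ p : ℕ, p.Prime → modPRank φ p = 0) {c : ℤ} (hc : c ≠ 0)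
    (hcN : ∀ w : IntegralModule φ, (C c : ℤ[T;T⁻¹]) • w = 0) : Finite N := by
  obtain ⟨m, gen, hgen⟩ := Module.Finite.exists_fin (R := ℤ[T;T⁻¹]) (M := IntegralModule φ)
  have hidx : ∀ p : ℕ, p.Prime → (nsmulAddMonoidHom (α := Additive N) p).range.index ≠ 0 := by
    intro p hp
    have : Fact p.Prime := ⟨hp⟩
    obtain ⟨s, hs, B, hB, hspan, -⟩ := exists_maximal_independent_modP (p := p) gen hgen
    have hs0 : s = ∅ := Finset.card_eq_zero.1 (hs.trans (hr p hp))
    subst hs0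
    have := finite_laurent_quotient hp hB
    have hfin : Finite (IntegralModule φ ⧸ multiples φ p) := by
      refine finite_quotient_of_forall_smul_mem (Ideal.span {C (p : ℤ), B}) _ fun a ha w => ?_
      obtain ⟨x, y, rfl⟩ := Ideal.mem_span_pair.1 ha
      rw [add_smul, mul_smul, mul_smul]
      refine Submodule.add_mem _ (Submodule.smul_mem _ _ ⟨w, rfl⟩) (Submodule.smul_mem _ _ ?_)
      have := hspan w
      rwa [Set.range_eq_empty, Submodule.span_empty, bot_sup_eq] at this
    have heq : (nsmulAddMonoidHom (α := Additive N) p).range =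
        (multiples φ p).toAddSubgroup.comap (toIntegralModule φ).toAddMonoidHom := by
      ext x
      refine Iff.trans ?_ (reduction_eq_zero_iff φ p (v := toIntegralModule φ x))
      exact ((Module.AEval'.of (generatorActionModP φ p)).map_eq_zero_iff.trans
        (QuotientAddGroup.eq_zero_iff _)).symm
    rw [heq, AddSubgroup.index_comap_of_surjective _ (toIntegralModule φ).surjective]
    have : Finite (IntegralModule φ ⧸ (multiples φ p).toAddSubgroup) := hfin
    exact Nat.card_pos.ne'
  have hbot : (nsmulAddMonoidHom (α := Additive N) c.natAbs).range = ⊥ := by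
    rw [eq_bot_iff]
    rintro _ ⟨x, rfl⟩
    have h := hcN (toIntegralModule φ x)
    rw [C_smul_integralModule] at h
    have h2 : c.natAbs • x = 0 := by
      rw [← natCast_zsmul, Int.natCast_natAbs]
      rcases abs_choice c with h3 | h3
      · rw [h3]; exact h
      · rw [h3, neg_smul, neg_eq_zero]; exact h
    exact h2
  have h := index_nsmul_range_ne_zero hidx (Int.natAbs_ne_zero.2 hc)
  rw [hbot, AddSubgroup.index_bot] at h
  exact Nat.finite_of_card_ne_zero h

end FiniteModules

/-! ### The dimensions of the spaces of semilinear maps -/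

section Dimensions

open LaurentPolynomial

variable {N : Type*} [CommGroup N] {φ : Multiplicative ℤ →* MulAut N}
  [Module.Finite ℤ[T;T⁻¹] (IntegralModule φ)]

variable (φ) in
/-- Over fields of characteristic `p` the generic dimension is `r(p)`. -/
theorem exists_homDim_eq_modPRank {p : ℕ} (hp : p.Prime) :
    ∃ A : ℤ[T;T⁻¹], ¬ C (p : ℤ) ∣ A ∧ ∀ (F : Type) [Field F] [CharP F p]
      (l : ℤ[T;T⁻¹] →+* F), l A ≠ 0 → homDim (IntegralModule φ) l = modPRank φ p := by
  have : Fact p.Prime := ⟨hp⟩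
  obtain ⟨m, gen, hgen⟩ := Module.Finite.exists_fin (R := ℤ[T;T⁻¹]) (M := IntegralModule φ)
  obtain ⟨s, hs, B, hB, hspan, hind⟩ := exists_maximal_independent_modP (p := p) gen hgen
  refine ⟨B, hB, fun F _ _ l hl => ?_⟩
  have hlp : l (C (p : ℤ)) = 0 := by simp
  rw [← hs, ← Fintype.card_coe]
  refine le_antisymm (homDim_le l (fun i : s => gen i) B hl (multiples φ p) ?_ hspan)
    (le_homDim l (fun i : s => gen i) B hl (multiples φ p) (Ideal.span {C (p : ℤ)}) ?_ hspan hind)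
  · rintro f _ ⟨w, rfl⟩
    rw [LinearMap.lsmul_apply, LinearMap.map_smulₛₗ, hlp, zero_smul]
  · intro a ha
    obtain ⟨b, rfl⟩ := Ideal.mem_span_singleton.1 ha
    rw [map_mul, hlp, zero_mul]

variable (φ) in
theorem bddAbove_modPRank : BddAbove (Set.range fun p : Nat.Primes => modPRank φ p) := by
  obtain ⟨m, gen, hgen⟩ := Module.Finite.exists_fin (R := ℤ[T;T⁻¹]) (M := IntegralModule φ)
  refine ⟨m, ?_⟩
  rintro _ ⟨p, rfl⟩
  have : Fact p.1.Prime := ⟨p.2⟩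
  obtain ⟨s, hs, -⟩ := exists_maximal_independent_modP (p := p.1) gen hgen
  dsimp only
  rw [← hs]
  exact (Finset.card_le_univ s).trans (Fintype.card_fin m).le

theorem modPRank_le_maxModPRank {p : ℕ} (hp : p.Prime) : modPRank φ p ≤ maxModPRank φ :=
  le_ciSup (bddAbove_modPRank φ) (⟨p, hp⟩ : Nat.Primes)

variable (φ) in
theorem exists_modPRank_eq_maxModPRank : ∃ p : ℕ, p.Prime ∧ modPRank φ p = maxModPRank φ := by
  have : Nonempty Nat.Primes := ⟨⟨2, Nat.prime_two⟩⟩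
  obtain ⟨p, hp⟩ := Nat.sSup_mem (Set.range_nonempty fun p : Nat.Primes => modPRank φ p)
    (bddAbove_modPRank φ)
  exact ⟨p, p.2, hp⟩

/-- Away from finitely many characteristics the dimension is at most `s(0) + r(0)`, it is
generically at most `r(0)`, and it is at least `s(0) + r(0)` where all the `a j` vanish. -/
theorem exists_homDim_bounds {s₀ r₀ : ℕ} {a : Fin s₀ → ℚ[T;T⁻¹]} (ha : ∀ j, a j ≠ 0)
    (e : RationalModule φ ≃ₗ[ℚ[T;T⁻¹]]
      ((j : Fin s₀) → ℚ[T;T⁻¹] ⧸ Ideal.span {a j}) × (Fin r₀ → ℚ[T;T⁻¹])) :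
    ∃ (c : ℤ) (A : ℤ[T;T⁻¹]), c ≠ 0 ∧ A ≠ 0 ∧
      (s₀ + r₀ = 0 → ∀ w : IntegralModule φ, (C c : ℤ[T;T⁻¹]) • w = 0) ∧
      ∀ (F : Type) [Field F] (l : ℤ[T;T⁻¹] →+* F), l (C c) ≠ 0 →
        homDim (IntegralModule φ) l ≤ s₀ + r₀ ∧
        (l A ≠ 0 → homDim (IntegralModule φ) l ≤ r₀) ∧
        ((∀ j B, laurentIntToRat B ∈ Ideal.span {a j} → l B = 0) →
          s₀ + r₀ ≤ homDim (IntegralModule φ) l) := by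
  obtain ⟨v, c, A, hc, hA, hspan, hAv, hind⟩ := exists_integral_generators φ ha e
  refine ⟨c, A, hc, hA, fun h0 w => ?_, fun F _ l hl => ?_⟩
  · have : IsEmpty (Fin s₀ ⊕ Fin r₀) := by
      obtain ⟨rfl, rfl⟩ := Nat.add_eq_zero_iff.1 h0
      infer_instance
    have h := hspan w
    rwa [Set.range_eq_empty, Submodule.span_empty, Submodule.mem_bot] at h
  refine ⟨?_, fun hlA => ?_, fun hlB => ?_⟩
  · have h := homDim_le l v (C c) hl ⊥ (by simp) (fun w => Submodule.mem_sup_left (hspan w))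
    simpa using h
  -- `A` kills the generators of the torsion summands
  · have h := homDim_le l (fun i => v (Sum.inr i)) (A * C c)
      (by rw [map_mul]; exact mul_ne_zero hlA hl) ⊥ (by simp) (fun w => ?_)
    · simpa using h
    · refine Submodule.mem_sup_left ?_
      have hle : Submodule.span ℤ[T;T⁻¹] (Set.range v) ≤
          (Submodule.span ℤ[T;T⁻¹] (Set.range fun i => v (Sum.inr i))).comap
            (LinearMap.lsmul _ _ A) := by
        rw [Submodule.span_le]
        rintro _ ⟨i | i, rfl⟩
        · rw [SetLike.mem_coe, Submodule.mem_comap, LinearMap.lsmul_apply, hAv]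
          exact Submodule.zero_mem _
        · have h := Submodule.subset_span (R := ℤ[T;T⁻¹])
            (Set.mem_range_self (f := fun i => v (Sum.inr i)) i)
          exact Submodule.smul_mem _ A h
      rw [mul_smul]
      exact hle (hspan w)
  · have h := le_homDim l v (C c) hl ⊥ (RingHom.ker l) (fun b hb => hb)
      (fun w => Submodule.mem_sup_left (hspan w)) (fun f hf i => ?_)
    · simpa using h
    · obtain ⟨h1, h2⟩ := hind f ((Submodule.mem_bot _).1 hf)
      rcases i with j | i
      · exact hlB j _ (h1 j)
      · rw [h2 i]; exact map_zero l

theorem map_C_ne_zero {F : Type*} [Field F] {p : ℕ} [CharP F p] {c : ℤ} (hc : ¬ (p : ℤ) ∣ c)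
    (l : ℤ[T;T⁻¹] →+* F) : l (C c) ≠ 0 := by
  have : l (C c) = (c : F) := by simp
  rw [this]
  exact fun h => hc ((CharP.intCast_eq_zero_iff F p c).1 h)

end Dimensions

/-! ### Maximal submodules of prime power index -/

section PrimePowerIndex

open LaurentPolynomial

variable {N : Type*} [CommGroup N] {φ : Multiplicative ℤ →* MulAut N}

theorem maxSubmoduleCount_eq_zero {R V : Type*} [CommRing R] [AddCommGroup V] [Module R V] {n : ℕ}
    (h0 : n ≠ 0) (hn : ¬ IsPrimePow n) : maxSubmoduleCount R V n = 0 := by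
  refine (congrArg Set.ncard (Set.eq_empty_of_forall_notMem ?_)).trans (Set.ncard_empty _)
  rintro W ⟨hW, rfl⟩
  exact hn (isPrimePow_of_isCoatom hW h0)

variable [Module.Finite ℤ[T;T⁻¹] (IntegralModule φ)]

variable (φ) in
/-- For a fixed prime `p`, only the generic dimension `r(p)` matters once `k` is large. -/
theorem exists_maxSubmoduleCount_mul_le {p : ℕ} (hp : p.Prime) : ∃ D : ℕ, ∀ k, D < k →
    maxSubmoduleCount ℤ[T;T⁻¹] (IntegralModule φ) (p ^ k) * (k * (p ^ k - 1)) ≤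
      p ^ k * ((p ^ k) ^ modPRank φ p - 1) := by
  have : Fact p.Prime := ⟨hp⟩
  obtain ⟨A, hA, hdim⟩ := exists_homDim_eq_modPRank φ hp
  obtain ⟨D, hD⟩ := exists_card_zero_le A
  refine ⟨D, fun k hk => ?_⟩
  have hF := GaloisField.card p k (by omega)
  refine maxSubmoduleCount_mul_le_of_surjective hF
    (by rw [card_laurentHom, hF]; exact Nat.sub_le _ _) fun l hl => (hdim _ l fun h => ?_).le
  have := le_card_zero_of_surjective hF hl h
  have := hD p hA (GaloisField p k)
  omega

variable (φ) in
/-- For `k` prime most homomorphisms to the field of `p ^ k` elements are surjective. -/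
theorem exists_le_maxSubmoduleCount_mul {p : ℕ} (hp : p.Prime) : ∃ D : ℕ, ∀ k, k.Prime → D < k →
    (p ^ k - p) * ((p ^ k) ^ modPRank φ p - 1) ≤
      maxSubmoduleCount ℤ[T;T⁻¹] (IntegralModule φ) (p ^ k) * (k * (p ^ k - 1)) := by
  have : Fact p.Prime := ⟨hp⟩
  obtain ⟨A, hA, hdim⟩ := exists_homDim_eq_modPRank φ hp
  obtain ⟨D, hD⟩ := exists_card_zero_le A
  refine ⟨D, fun k hkp hk => ?_⟩
  have hF := GaloisField.card p k (by omega)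
  refine le_maxSubmoduleCount_mul hF (le_card_surjective_of_prime_exponent hkp hF)
    fun l hl => (hdim _ l fun h => ?_).ge
  have := le_card_zero_of_surjective hF hl h
  have := hD p hA (GaloisField p k)
  omega

/-- A bound, uniform over all primes `p` but finitely many. -/
theorem exists_uniform_maxSubmoduleCount_mul_le {s₀ r₀ : ℕ} {a : Fin s₀ → ℚ[T;T⁻¹]}
    (ha : ∀ j, a j ≠ 0)
    (e : RationalModule φ ≃ₗ[ℚ[T;T⁻¹]]
      ((j : Fin s₀) → ℚ[T;T⁻¹] ⧸ Ideal.span {a j}) × (Fin r₀ → ℚ[T;T⁻¹])) :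
    ∃ D M : ℕ, ∀ p : ℕ, p.Prime → M < p → ∀ k, k ≠ 0 →
      maxSubmoduleCount ℤ[T;T⁻¹] (IntegralModule φ) (p ^ k) * (k * (p ^ k - 1)) ≤
        p ^ k * ((p ^ k) ^ r₀ - 1) + D * ((p ^ k) ^ (s₀ + r₀) - 1) := by
  obtain ⟨c, A, hc, hA, -, hdim⟩ := exists_homDim_bounds ha e
  obtain ⟨D, hD⟩ := exists_card_zero_le A
  obtain ⟨M, hM⟩ := (finite_setOf_C_dvd hA).bddAbove
  refine ⟨D, max M c.natAbs, fun p hp hpM k hk => ?_⟩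
  have : Fact p.Prime := ⟨hp⟩
  have hpc : ¬ (p : ℤ) ∣ c := fun h => by
    have := Nat.le_of_dvd (Int.natAbs_pos.2 hc) (Int.natCast_dvd.1 h)
    have := le_max_right M c.natAbs
    omega
  have hpA : ¬ C (p : ℤ) ∣ A := fun h =>
    absurd (hM h) (not_le.2 ((le_max_left _ _).trans_lt hpM))
  have hF := GaloisField.card p k hk
  have hl := fun l : ℤ[T;T⁻¹] →+* GaloisField p k => hdim _ l (map_C_ne_zero hpc l)
  exact maxSubmoduleCount_mul_le hF (by rw [card_laurentHom, hF]; exact Nat.sub_le _ _)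
    (hD p hpA _) (fun l => (hl l).1) (fun l => (hl l).2.1)

theorem infinite_setOf_prime_gt (M : ℕ) : {p : ℕ | p.Prime ∧ M < p}.Infinite := by
  rw [Set.infinite_iff_exists_gt]
  intro K
  obtain ⟨p, hp, hpp⟩ := Nat.exists_infinite_primes (max M K + 1)
  exact ⟨p, ⟨hpp, by omega⟩, by omega⟩

/-- If `ℚ ⊗ N` has torsion, the dimension `s(0) + r(0)` occurs over infinitely many prime fields. -/
theorem infinite_setOf_le_maxSubmoduleCount {s₀ r₀ : ℕ} (hs : s₀ ≠ 0) {a : Fin s₀ → ℚ[T;T⁻¹]}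
    (ha : ∀ j, a j ≠ 0) (hu : ∀ j, ¬ IsUnit (a j)) (hdvd : ∀ i j, i ≤ j → a i ∣ a j)
    (e : RationalModule φ ≃ₗ[ℚ[T;T⁻¹]]
      ((j : Fin s₀) → ℚ[T;T⁻¹] ⧸ Ideal.span {a j}) × (Fin r₀ → ℚ[T;T⁻¹])) :
    {p : ℕ | p.Prime ∧ p ^ (s₀ + r₀) - 1 ≤
      maxSubmoduleCount ℤ[T;T⁻¹] (IntegralModule φ) p * (p - 1)}.Infinite := by
  obtain ⟨c, A, hc, -, -, hdim⟩ := exists_homDim_bounds ha e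
  let j₀ : Fin s₀ := ⟨0, Nat.pos_of_ne_zero hs⟩
  refine ((infinite_setOf_prime_hom (ha j₀) (hu j₀)).sdiff (Set.finite_le_nat c.natAbs)).mono ?_
  rintro p ⟨⟨hp, l, hl⟩, hpM⟩
  have : Fact p.Prime := ⟨hp⟩
  have hpc : ¬ (p : ℤ) ∣ c := fun h =>
    hpM (Nat.le_of_dvd (Int.natAbs_pos.2 hc) (Int.natCast_dvd.1 h))
  have hF : Nat.card (ZMod p) = p ^ 1 := by rw [Nat.card_zmod, pow_one]
  have h := le_maxSubmoduleCount_mul_of_exists (V := IntegralModule φ) hF l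
    (ZMod.ringHom_surjective l) ((hdim _ l (map_C_ne_zero hpc l)).2.2 fun j B hB =>
      hl B (Ideal.span_singleton_le_span_singleton.2 (hdvd j₀ j (Nat.zero_le _)) hB))
  rw [pow_one, one_mul] at h
  exact ⟨hp, h⟩

theorem exists_forall_prime_le_maxSubmoduleCount {r₀ : ℕ} {a : Fin 0 → ℚ[T;T⁻¹]}
    (e : RationalModule φ ≃ₗ[ℚ[T;T⁻¹]]
      ((j : Fin 0) → ℚ[T;T⁻¹] ⧸ Ideal.span {a j}) × (Fin r₀ → ℚ[T;T⁻¹])) :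
    ∃ M : ℕ, ∀ p : ℕ, p.Prime → M < p →
      p ^ r₀ - 1 ≤ maxSubmoduleCount ℤ[T;T⁻¹] (IntegralModule φ) p := by
  obtain ⟨c, A, hc, -, -, hdim⟩ := exists_homDim_bounds (fun j => j.elim0) e
  refine ⟨c.natAbs, fun p hp hpM => ?_⟩
  have : Fact p.Prime := ⟨hp⟩
  have hpc : ¬ (p : ℤ) ∣ c := fun h =>
    absurd (Nat.le_of_dvd (Int.natAbs_pos.2 hc) (Int.natCast_dvd.1 h)) (not_le.2 hpM)
  have hF : Nat.card (ZMod p) = p ^ 1 := by rw [Nat.card_zmod, pow_one]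
  have h := le_maxSubmoduleCount_mul (V := IntegralModule φ) (r := 0 + r₀) hF
    (card_surjective_of_card_eq_prime (Nat.card_zmod p)).ge
    fun l _ => (hdim _ l (map_C_ne_zero hpc l)).2.2 fun j => j.elim0
  rw [pow_one, one_mul, zero_add, mul_comm] at h
  exact Nat.le_of_mul_le_mul_right h (Nat.sub_pos_of_lt hp.one_lt)

/-- If `ℚ ⊗ N` is free then `r(0) ≤ r(p)` for some prime `p`. -/
theorem le_maxModPRank {r₀ : ℕ} {a : Fin 0 → ℚ[T;T⁻¹]}
    (e : RationalModule φ ≃ₗ[ℚ[T;T⁻¹]]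
      ((j : Fin 0) → ℚ[T;T⁻¹] ⧸ Ideal.span {a j}) × (Fin r₀ → ℚ[T;T⁻¹])) :
    r₀ ≤ maxModPRank φ := by
  obtain ⟨c, A, hc, -, -, hdim⟩ := exists_homDim_bounds (fun j => j.elim0) e
  obtain ⟨p, hpM, hp⟩ := Nat.exists_infinite_primes (c.natAbs + 1)
  have : Fact p.Prime := ⟨hp⟩
  have hpc : ¬ (p : ℤ) ∣ c := fun h =>
    absurd (Nat.le_of_dvd (Int.natAbs_pos.2 hc) (Int.natCast_dvd.1 h)) (not_le.2 hpM)
  obtain ⟨B, hB, hdimB⟩ := exists_homDim_eq_modPRank φ hp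
  obtain ⟨D, hD⟩ := exists_card_zero_le B
  -- a field with more than `D + 1` elements has a point at which `B` does not vanish
  have hF := GaloisField.card p (D + 2) (by omega)
  obtain ⟨l, hl⟩ : ∃ l : ℤ[T;T⁻¹] →+* GaloisField p (D + 2), l B ≠ 0 := by
    by_contra! h
    have h1 := hD p hB (GaloisField p (D + 2))
    rw [Nat.card_congr (Equiv.subtypeUnivEquiv h), card_laurentHom, hF] at h1
    have h2 : D + 2 < p ^ (D + 2) := Nat.lt_pow_self hp.one_lt
    omega
  have h := (hdim _ l (map_C_ne_zero hpc l)).2.2 fun j => j.elim0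
  rw [hdimB _ l hl, zero_add] at h
  exact h.trans (modPRank_le_maxModPRank hp)

end PrimePowerIndex

/-! ### Growth of the number of maximal subgroups -/

section Growth

open LaurentPolynomial

variable {N : Type*} [CommGroup N] {φ : Multiplicative ℤ →* MulAut N}

theorem mul_le_two_mul_of_mul_pred_le {c k n X : ℕ} (hn : 2 ≤ n) (h : c * (k * (n - 1)) ≤ X) :
    c * n * k ≤ 2 * X := by
  have h1 : n ≤ 2 * (n - 1) := by omega
  calc c * n * k ≤ c * (2 * (n - 1)) * k := by gcongr
    _ = 2 * (c * (k * (n - 1))) := by ring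
    _ ≤ 2 * X := by gcongr

variable [Module.Finite ℤ[T;T⁻¹] (IntegralModule φ)]

/-- The upper bound behind all three growth types: the first two terms come from almost all primes,
the last from the remaining ones. -/
theorem exists_maxSubgroupCount_le {s₀ r₀ : ℕ} {a : Fin s₀ → ℚ[T;T⁻¹]}
    (ha : ∀ j, a j ≠ 0)
    (e : RationalModule φ ≃ₗ[ℚ[T;T⁻¹]]
      ((j : Fin s₀) → ℚ[T;T⁻¹] ⧸ Ideal.span {a j}) × (Fin r₀ → ℚ[T;T⁻¹])) :
    ∃ C : ℝ, 0 ≤ C ∧ ∀ᶠ n : ℕ in Filter.atTop,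
      (maxSubgroupCount (N ⋊[φ] Multiplicative ℤ) n : ℝ) ≤
        C * ((n : ℝ) ^ (r₀ + 1) + (n : ℝ) ^ (s₀ + r₀) +
          (n : ℝ) ^ (maxModPRank φ + 1) / Real.log n) := by
  obtain ⟨D, M, hDM⟩ := exists_uniform_maxSubmoduleCount_mul_le ha e
  choose! E hE using fun (p : ℕ) (hp : p.Prime) => exists_maxSubmoduleCount_mul_le φ hp
  refine ⟨3 + 2 * D + 2 * M, by positivity, ?_⟩
  filter_upwards [Filter.eventually_ge_atTop (2 + ∑ p ∈ Finset.range (M + 1), p ^ E p)] with n hn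
  have hn2 : 2 ≤ n := by omega
  have hn1 : (1 : ℝ) ≤ n := by exact_mod_cast (by omega : 1 ≤ n)
  have hlog : 0 < Real.log n := Real.log_pos (by exact_mod_cast hn2)
  set X := (n : ℝ) ^ (r₀ + 1)
  set Y := (n : ℝ) ^ (s₀ + r₀)
  set Z := (n : ℝ) ^ (maxModPRank φ + 1) / Real.log n
  have hX : 1 ≤ X := one_le_pow₀ hn1
  have hY : 0 ≤ Y := by positivity
  have hZ : 0 ≤ Z := by positivity
  have hD0 : (0 : ℝ) ≤ D := Nat.cast_nonneg D
  have hM0 : (0 : ℝ) ≤ M := Nat.cast_nonneg M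
  set c := maxSubmoduleCount ℤ[T;T⁻¹] (IntegralModule φ) n with hc
  have hle : (maxSubgroupCount (N ⋊[φ] Multiplicative ℤ) n : ℝ) ≤ 1 + c * n := by
    exact_mod_cast maxSubgroupCount_le φ (by omega : n ≠ 0)
  suffices h : (c : ℝ) * n ≤ 2 * X + 2 * D * Y + 2 * M * Z by
    have h1 := mul_nonneg hD0 (zero_le_one.trans hX)
    have h2 := mul_nonneg hD0 hZ
    have h3 := mul_nonneg hM0 (zero_le_one.trans hX)
    have h4 := mul_nonneg hM0 hY
    nlinarith
  by_cases hpp : IsPrimePow n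
  swap
  · rw [hc, maxSubmoduleCount_eq_zero (by omega) hpp]
    simp only [Nat.cast_zero, zero_mul]
    positivity
  obtain ⟨p, k, hp, hk, hpk⟩ := (isPrimePow_nat_iff n).1 hpp
  rcases lt_or_ge M p with hpM | hpM
  · have h := hDM p hp hpM k hk.ne'
    rw [hpk, ← hc] at h
    have h1 : c * n ≤ 2 * (n ^ (r₀ + 1) + D * n ^ (s₀ + r₀)) := by
      refine (Nat.le_mul_of_pos_right _ hk).trans (mul_le_two_mul_of_mul_pred_le hn2 (h.trans ?_))
      rw [pow_succ']
      gcongr <;> exact Nat.sub_le _ _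
    have h2 : (c : ℝ) * n ≤ 2 * (X + D * Y) := by
      simp only [X, Y]
      exact_mod_cast h1
    have h3 := mul_nonneg hM0 hZ
    linarith
  · have hpE : p ^ E p < p ^ k := by
      have : p ^ E p ≤ ∑ p ∈ Finset.range (M + 1), p ^ E p :=
        Finset.single_le_sum (f := fun p => p ^ E p) (fun _ _ => Nat.zero_le _)
        (Finset.mem_range.2 (Nat.lt_succ_of_le hpM))
      rw [hpk]
      omega
    have h := hE p hp k ((Nat.pow_lt_pow_iff_right hp.one_lt).1 hpE)
    rw [hpk, ← hc] at h
    have h1 : c * n * k ≤ 2 * n ^ (maxModPRank φ + 1) := by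
      refine mul_le_two_mul_of_mul_pred_le hn2 (h.trans ?_)
      rw [pow_succ']
      gcongr
      exact (Nat.sub_le _ _).trans
        (Nat.pow_le_pow_right (by omega) (modPRank_le_maxModPRank hp))
    have h2 : (c : ℝ) * n * k ≤ 2 * (n : ℝ) ^ (maxModPRank φ + 1) := by exact_mod_cast h1
    have hlogn : Real.log n ≤ k * M := by
      rw [← hpk, Nat.cast_pow, Real.log_pow]
      gcongr
      exact (Real.log_le_self (Nat.cast_nonneg p)).trans (by exact_mod_cast hpM)
    have h3 : (c : ℝ) * n ≤ 2 * M * Z := by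
      rw [← mul_div_assoc, le_div_iff₀ hlog]
      calc (c : ℝ) * n * Real.log n ≤ c * n * (k * M) := by gcongr
        _ = c * n * k * M := by ring
        _ ≤ 2 * (n : ℝ) ^ (maxModPRank φ + 1) * M := by gcongr
        _ = _ := by ring
    have := mul_nonneg hD0 hY
    linarith

/-- The lower bound from a torsion summand of `ℚ ⊗ N`, at primes modulo which `a₁` has a root. -/
theorem frequently_pow_le_maxSubgroupCount {s₀ r₀ : ℕ} (hs : s₀ ≠ 0) {a : Fin s₀ → ℚ[T;T⁻¹]}
    (ha : ∀ j, a j ≠ 0) (hu : ∀ j, ¬ IsUnit (a j)) (hdvd : ∀ i j, i ≤ j → a i ∣ a j)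
    (e : RationalModule φ ≃ₗ[ℚ[T;T⁻¹]]
      ((j : Fin s₀) → ℚ[T;T⁻¹] ⧸ Ideal.span {a j}) × (Fin r₀ → ℚ[T;T⁻¹])) :
    ∃ᶠ n : ℕ in Filter.atTop, n ^ (s₀ + r₀) ≤ maxSubgroupCount (N ⋊[φ] Multiplicative ℤ) n := by
  rw [Nat.frequently_atTop_iff_infinite]
  refine (infinite_setOf_le_maxSubmoduleCount hs ha hu hdvd e).mono ?_
  rintro p ⟨hp, h⟩
  refine le_trans ?_ (le_maxSubgroupCount φ hp.ne_zero)
  refine Nat.le_of_mul_le_mul_right ?_ (Nat.sub_pos_of_lt hp.one_lt)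
  have hpd : p ≤ p ^ (s₀ + r₀) := Nat.le_self_pow (by omega) p
  calc p ^ (s₀ + r₀) * (p - 1) = p ^ (s₀ + r₀) * p - p ^ (s₀ + r₀) := by
        rw [Nat.mul_sub, mul_one]
    _ ≤ p ^ (s₀ + r₀) * p - p := Nat.sub_le_sub_left hpd _
    _ = (p ^ (s₀ + r₀) - 1) * p := by rw [Nat.sub_mul, one_mul]
    _ ≤ maxSubmoduleCount ℤ[T;T⁻¹] (IntegralModule φ) p * (p - 1) * p := by gcongr
    _ = _ := by ring

/-- The lower bound for `ℚ ⊗ N` free of positive rank, at almost all primes. -/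
theorem frequently_pow_succ_le_maxSubgroupCount {r₀ : ℕ} (hr : r₀ ≠ 0) {a : Fin 0 → ℚ[T;T⁻¹]}
    (e : RationalModule φ ≃ₗ[ℚ[T;T⁻¹]]
      ((j : Fin 0) → ℚ[T;T⁻¹] ⧸ Ideal.span {a j}) × (Fin r₀ → ℚ[T;T⁻¹])) :
    ∃ᶠ n : ℕ in Filter.atTop,
      n ^ (r₀ + 1) ≤ 2 * maxSubgroupCount (N ⋊[φ] Multiplicative ℤ) n := by
  obtain ⟨M, hM⟩ := exists_forall_prime_le_maxSubmoduleCount e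
  rw [Nat.frequently_atTop_iff_infinite]
  refine (infinite_setOf_prime_gt M).mono ?_
  rintro p ⟨hp, hpM⟩
  refine le_trans ?_ (Nat.mul_le_mul_left 2 (le_maxSubgroupCount φ hp.ne_zero))
  have hpd : p ≤ p ^ r₀ := Nat.le_self_pow hr p
  have h2 := hp.two_le
  have h3 := hM p hp hpM
  rw [pow_succ, ← mul_assoc]
  gcongr
  omega

variable (φ) in
/-- The lower bound from a prime `p` with `r(p) = r_max`, at the powers of `p` with large prime
exponent. -/
theorem exists_frequently_div_log_le_maxSubgroupCount (hr : maxModPRank φ ≠ 0) :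
    ∃ C : ℝ, 0 < C ∧ ∃ᶠ n : ℕ in Filter.atTop,
      C * ((n : ℝ) ^ (maxModPRank φ + 1) / Real.log n) ≤
        (maxSubgroupCount (N ⋊[φ] Multiplicative ℤ) n : ℝ) := by
  obtain ⟨p, hp, hpr⟩ := exists_modPRank_eq_maxModPRank φ
  obtain ⟨D, hD⟩ := exists_le_maxSubmoduleCount_mul φ hp
  have hlogp : 0 < Real.log p := Real.log_pos (by exact_mod_cast hp.one_lt)
  refine ⟨Real.log p / 4, by positivity, ?_⟩
  rw [Nat.frequently_atTop_iff_infinite]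
  refine ((infinite_setOf_prime_gt D).image
    (Nat.pow_right_injective hp.two_le).injOn).mono ?_
  rintro _ ⟨k, ⟨hk, hkD⟩, rfl⟩
  have h := hD k hk hkD
  rw [hpr] at h
  have hlog : Real.log ((p ^ k : ℕ) : ℝ) = k * Real.log p := by
    rw [Nat.cast_pow, Real.log_pow]
  change Real.log p / 4 * (((p ^ k : ℕ) : ℝ) ^ (maxModPRank φ + 1) / Real.log ((p ^ k : ℕ) : ℝ)) ≤ _
  rw [hlog]
  have hn : 2 * p ≤ p ^ k := by
    calc 2 * p ≤ p * p := Nat.mul_le_mul_right _ hp.two_le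
      _ = p ^ 2 := (sq p).symm
      _ ≤ p ^ k := Nat.pow_le_pow_right hp.pos hk.two_le
  set n := p ^ k
  have hp2 := hp.two_le
  have hnr : n ≤ n ^ maxModPRank φ := Nat.le_self_pow hr n
  set c := maxSubmoduleCount ℤ[T;T⁻¹] (IntegralModule φ) n
  have h1 : n ^ (maxModPRank φ + 1) ≤ 4 * (c * n * k) := by
    calc n ^ (maxModPRank φ + 1) = n * n ^ maxModPRank φ := pow_succ' _ _
      _ ≤ (2 * (n - p)) * (2 * (n ^ maxModPRank φ - 1)) := by
        gcongr <;> omega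
      _ = 4 * ((n - p) * (n ^ maxModPRank φ - 1)) := by ring
      _ ≤ 4 * (c * (k * (n - 1))) := by gcongr
      _ ≤ 4 * (c * (k * n)) := by gcongr; exact Nat.sub_le _ _
      _ = _ := by ring
  have h2 : c * n ≤ maxSubgroupCount (N ⋊[φ] Multiplicative ℤ) n :=
    le_maxSubgroupCount φ (by omega)
  have h3 : n ^ (maxModPRank φ + 1) ≤ 4 * (maxSubgroupCount (N ⋊[φ] Multiplicative ℤ) n * k) :=
    h1.trans (by gcongr)
  have h4 : (n : ℝ) ^ (maxModPRank φ + 1) ≤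
      4 * (maxSubgroupCount (N ⋊[φ] Multiplicative ℤ) n * k) := by exact_mod_cast h3
  have hk0 : (0 : ℝ) < k := by exact_mod_cast hk.pos
  have heq : Real.log p / 4 * ((n : ℝ) ^ (maxModPRank φ + 1) / (k * Real.log p)) =
      (n : ℝ) ^ (maxModPRank φ + 1) / (4 * k) := by
    field_simp
  rw [heq, div_le_iff₀ (by positivity)]
  linarith

end Growth

theorem mainTheorem4 {N : Type*} [CommGroup N] [Infinite N]
    (φ : Multiplicative ℤ →* MulAut N)
    (hG : Group.FG (N ⋊[φ] Multiplicative ℤ))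
    (s₀ r₀ : ℕ) (a : Fin s₀ → ℚ[T;T⁻¹])
    (ha_ne_zero : ∀ j, a j ≠ 0) (ha_not_unit : ∀ j, ¬ IsUnit (a j))
    (ha_dvd : ∀ i j, i ≤ j → a i ∣ a j)
    (hQN : Nonempty (RationalModule φ ≃ₗ[ℚ[T;T⁻¹]]
      ((j : Fin s₀) → ℚ[T;T⁻¹] ⧸ Ideal.span {a j}) × (Fin r₀ → ℚ[T;T⁻¹])))
    (d : ℕ) (hd : d = s₀ + r₀) :
    (d > maxModPRank φ →
      HasGrowthType (fun n => (maxSubgroupCount (N ⋊[φ] Multiplicative ℤ) n : ℝ))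
        (fun n => (n : ℝ) ^ d)) ∧
    (d = maxModPRank φ ∧ maxModPRank φ = r₀ →
      HasGrowthType (fun n => (maxSubgroupCount (N ⋊[φ] Multiplicative ℤ) n : ℝ))
        (fun n => (n : ℝ) ^ (d + 1))) ∧
    (¬ d > maxModPRank φ ∧ ¬ (d = maxModPRank φ ∧ maxModPRank φ = r₀) →
      HasGrowthType (fun n => (maxSubgroupCount (N ⋊[φ] Multiplicative ℤ) n : ℝ))
        (fun n => (n : ℝ) ^ (maxModPRank φ + 1) / Real.log n)) := by
  subst hd
  have := finite_integralModule hG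
  obtain ⟨e⟩ := hQN
  obtain ⟨C, hC, hupper⟩ := exists_maxSubgroupCount_le ha_ne_zero e
  -- it suffices to dominate each of the three terms of the upper bound
  have hO : ∀ g : ℕ → ℝ, (∀ n : ℕ, 3 ≤ n → (n : ℝ) ^ (r₀ + 1) ≤ g n ∧ (n : ℝ) ^ (s₀ + r₀) ≤ g n ∧
      (n : ℝ) ^ (maxModPRank φ + 1) / Real.log n ≤ g n) →
      ∃ C : ℝ, ∀ᶠ n : ℕ in Filter.atTop,
        |(maxSubgroupCount (N ⋊[φ] Multiplicative ℤ) n : ℝ)| ≤ C * g n := by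
    intro g hg
    refine ⟨C * 3, ?_⟩
    filter_upwards [hupper, Filter.eventually_ge_atTop 3] with n hn h3
    obtain ⟨h1, h2, h3⟩ := hg n h3
    rw [abs_of_nonneg (Nat.cast_nonneg _), mul_assoc]
    refine hn.trans (mul_le_mul_of_nonneg_left ?_ hC)
    linarith
  have hlog : ∀ n : ℕ, 3 ≤ n → 1 ≤ Real.log n := fun n hn => by
    rw [Real.le_log_iff_exp_le (by positivity)]
    exact Real.exp_one_lt_three.le.trans (by exact_mod_cast hn)
  have hpow : ∀ n : ℕ, 3 ≤ n → ∀ {i j : ℕ}, i ≤ j → (n : ℝ) ^ i ≤ (n : ℝ) ^ j := fun n hn i j h =>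
    pow_le_pow_right₀ (by exact_mod_cast (by omega : 1 ≤ n)) h
  have hdiv : ∀ n : ℕ, 3 ≤ n → ∀ i : ℕ, (n : ℝ) ^ i / Real.log n ≤ (n : ℝ) ^ i := fun n hn i =>
    div_le_self (by positivity) (hlog n hn)
  refine ⟨fun h1 => ?_, fun h2 => ?_, fun h3 => ?_⟩
  -- `ℚ ⊗ N` has torsion, as `r₀ ≤ r_max` if it is free
  · have hs : s₀ ≠ 0 := by
      rintro rfl
      have := le_maxModPRank e
      omega
    refine ⟨hO _ fun n hn => ⟨hpow n hn (by omega), le_rfl,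
      (hdiv n hn _).trans (hpow n hn h1)⟩, 1, one_pos, ?_⟩
    refine (frequently_pow_le_maxSubgroupCount hs ha_ne_zero ha_not_unit ha_dvd e).mono
      fun n hn => ?_
    beta_reduce
    rw [one_mul]
    exact_mod_cast hn
  · obtain rfl : s₀ = 0 := by omega
    -- otherwise `N` is torsion with finite reductions `N / pN`, so finite
    have hr : r₀ ≠ 0 := by
      rintro rfl
      obtain ⟨c, A, hc, -, htors, -⟩ := exists_homDim_bounds ha_ne_zero e
      refine not_finite_iff_infinite.2 ‹Infinite N›
        (finite_of_modPRank_eq_zero (φ := φ) (fun p hp => ?_) hc (htors rfl))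
      exact Nat.le_zero.1 ((modPRank_le_maxModPRank hp).trans h2.2.le)
    refine ⟨hO _ fun n hn => ⟨hpow n hn (by omega), hpow n hn (by omega),
      (hdiv n hn _).trans (hpow n hn (by omega))⟩, 1 / 2, by norm_num, ?_⟩
    refine (frequently_pow_succ_le_maxSubgroupCount hr e).mono fun n hn => ?_
    have : (n : ℝ) ^ (r₀ + 1) ≤ 2 * maxSubgroupCount (N ⋊[φ] Multiplicative ℤ) n := by
      exact_mod_cast hn
    rw [zero_add]
    linarith
  · have hle : ∀ n : ℕ, 3 ≤ n → (n : ℝ) ^ maxModPRank φ ≤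
        (n : ℝ) ^ (maxModPRank φ + 1) / Real.log n := fun n hn => by
      rw [le_div_iff₀ (zero_lt_one.trans_le (hlog n hn)), pow_succ]
      gcongr
      exact Real.log_le_self (Nat.cast_nonneg n)
    exact ⟨hO _ fun n hn => ⟨(hpow n hn (by omega)).trans (hle n hn),
      (hpow n hn (by omega)).trans (hle n hn), le_rfl⟩,
      exists_frequently_div_log_le_maxSubgroupCount φ (by omega)⟩
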